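/- Let $d$ be a dimension. For functions $f,g$ on $\mathbb{R}^n$ let $V_g f(x,\omega)=\int_{\mathbb{R}^n} f(t)\,\overline{g(t-x)}\,e^{-2\pi i\,\omega\cdot t}\,dt$ be the short-time Fourier transform, and let $\widehat f(\omega)=\int f(x)e^{-2\pi i x\cdot\omega}\,dx$. Let $\mathcal S^{(1)}(\mathbb{R}^n)$ be the Gelfand–Shilov space of smooth functions $f$ such that $f(x)e^{h|x|}$ and $\widehat f(\omega)e^{h|\omega|}$ are bounded for every $h>0$. Given a window $\varphi\in\mathcal S^{(1)}(\mathbb{R}^n)\setminus\{0\}$, the Feichtinger algebra $S_0(\mathbb{R}^n)$ is the space of all $f\in L^2(\mathbb{R}^n)$ with $\|f\|_{S_0}:=\|V_\varphi f\|_{L^1(\mathbb{R}^{2n})}<\infty$, normed by $\|\cdot\|_{S_0}$. Fix arbitrary such windows for $S_0(\mathbb{R}^d)$ and for $S_0(\mathbb{R}^{2d})$, and identify $\mathbb{R}^{2d}$ with $\mathbb{R}^d_x\times\mathbb{R}^d_\omega$. Let $g\in S_0(\mathbb{R}^d)\setminus\{0\}$. For $F,H\in S_0(\mathbb{R}^{2d})$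 the Gabor product is $$(F\,\natural_g H)(x,\omega)=\int_{\mathbb{R}^{3d}}\overline{\widehat g(\omega'+\omega''-\omega)}\,F(x',\omega')\,H(x',\omega'')\,e^{2\pi i\,x\cdot(\omega'+\omega''-\omega)}\,dx'\,d\omega'\,d\omega''.$$ Then: 1. $\natural_g$ is well defined: for all $F,H\in S_0(\mathbb{R}^{2d})$ and all $x,\omega\in\mathbb{R}^d$ the integral converges absolutely. 2. $F\,\natural_g H\in S_0(\mathbb{R}^{2d})$, and $\natural_g:S_0(\mathbb{R}^{2d})\times S_0(\mathbb{R}^{2d})\to S_0(\mathbb{R}^{2d})$ is a continuous mapping; moreover there is a constant $C$, independent of $F$ and $H$, with $\|F\,\natural_g H\|_{S_0}\le C\,\|F\|_{S_0}\|H\|_{S_0}$. 3. For all $F,H\in S_0(\mathbb{R}^{2d})$, the integral $\widehat A_{F,H}(\xi)=\int_{\mathbb{R}^{2d}}F(x',\omega')\,H(x',\xi-\omega')\,dx'\,d\omega'$ converges absolutely for every $\xi\in\mathbb{R}^d$; the function $\widehat A_{F,H}$ and its inverse Fourier transform $A_{F,H}$ belong to $S_0(\mathbb{R}^d)$; the Fourier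 transform of $A_{F,H}$ is $\widehat A_{F,H}$; and $(F\,\natural_g H)(x,\omega)=V_g A_{F,H}(x,\omega)$ for all $x,\omega\in\mathbb{R}^d$. -/

import Mathlib

open MeasureTheory FourierTransform ComplexConjugate
open scoped ENNReal InnerProductSpace

noncomputable section

namespace GaborProduct

section General

variable {V : Type*} [NormedAddCommGroup V] [InnerProductSpace ℝ V] [FiniteDimensional ℝ V]
  [MeasurableSpace V] [BorelSpace V]

/-- The short-time Fourier transform
`V_g f (x, ω) = ∫ f(t) conj(g(t - x)) e^{-2πi ω·t} dt`. -/
def stft (g f : V → ℂ) (x ω : V) : ℂ :=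
  ∫ t, f t * conj (g (t - x)) * Complex.exp (-2 * Real.pi * Complex.I * (⟪ω, t⟫_ℝ : ℂ))

/-- Membership in the Gelfand–Shilov space `S^{(1)}(V)`: smooth functions `f` such that
`f(x) e^{h|x|}` and `f̂(ω) e^{h|ω|}` are bounded for every `h > 0`. -/
structure IsGelfandShilov (f : V → ℂ) : Prop where
  smooth : ContDiff ℝ ((⊤ : ℕ∞) : WithTop ℕ∞) f
  decay : ∀ h : ℝ, 0 < h → ∃ C : ℝ, ∀ x, ‖f x‖ * Real.exp (h * ‖x‖) ≤ C
  decay_fourier : ∀ h : ℝ, 0 < h → ∃ C : ℝ, ∀ ω, ‖𝓕 f ω‖ * Real.exp (h * ‖ω‖) ≤ C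

variable (V) in
/-- The nonzero elements of `S^{(1)}(V)`. -/
structure Window where
  toFun : V → ℂ
  isGelfandShilov : IsGelfandShilov toFun
  ne_zero : toFun ≠ 0

lemma Window.continuous (φ : Window V) : Continuous φ.toFun :=
  φ.isGelfandShilov.smooth.continuous

lemma Window.memLp_two (φ : Window V) : MemLp φ.toFun 2 (volume : Measure V) := by
  rw [memLp_two_iff_integrable_sq_norm φ.continuous.aestronglyMeasurable]
  set r : ℝ := Module.finrank ℝ V + 1 with hr
  have hr0 : 0 < r := by positivity
  obtain ⟨C, hC⟩ := φ.isGelfandShilov.decay r hr0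
  have hint : Integrable (fun x : V => C ^ 2 * (1 + ‖x‖) ^ (-r)) volume :=
    (integrable_one_add_norm (by rw [hr]; linarith)).const_mul _
  refine hint.mono' (φ.continuous.norm.pow 2).aestronglyMeasurable (Filter.Eventually.of_forall ?_)
  intro x
  have hx := hC x
  have h1 : (1 + ‖x‖) ^ r ≤ Real.exp (r * ‖x‖) := by
    rw [mul_comm, Real.exp_mul]
    exact Real.rpow_le_rpow (by positivity) (by linarith [Real.add_one_le_exp ‖x‖]) hr0.le
  have h2 : 1 ≤ (1 + ‖x‖) ^ r := Real.one_le_rpow (by linarith [norm_nonneg x]) hr0.le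
  have h3 : ‖φ.toFun x‖ * (1 + ‖x‖) ^ r ≤ C :=
    (mul_le_mul_of_nonneg_left h1 (norm_nonneg _)).trans hx
  have h4 : ‖φ.toFun x‖ ≤ C := by nlinarith [norm_nonneg (φ.toFun x)]
  rw [Real.norm_of_nonneg (by positivity), Real.rpow_neg (by positivity), ← div_eq_mul_inv,
    le_div_iff₀ (by positivity)]
  nlinarith [norm_nonneg (φ.toFun x)]

lemma integrable_mul_shift {f g : V → ℂ} (hf : MemLp f 2 (volume : Measure V))
    (hg : MemLp g 2 (volume : Measure V)) (x : V) :
    Integrable (fun t => f t * conj (g (t - x))) (volume : Measure V) := by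
  have hg' : MemLp (fun t => conj (g (t - x))) 2 (volume : Measure V) :=
    (hg.comp_measurePreserving (measurePreserving_sub_right volume x)).star
  exact hf.integrable_mul hg'

lemma stft_eq_fourier (g f : V → ℂ) (x ω : V) :
    stft g f x ω = 𝓕 (fun t => f t * conj (g (t - x))) ω := by
  rw [stft, Real.fourier_eq']
  refine integral_congr_ae (Filter.Eventually.of_forall fun t => ?_)
  simp only [smul_eq_mul]
  rw [mul_comm, real_inner_comm]
  congr 2
  push_cast
  ring

lemma integrable_stft_integrand {f g : V → ℂ} (hf : MemLp f 2 (volume : Measure V))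
    (hg : MemLp g 2 (volume : Measure V)) (x ω : V) :
    Integrable (fun t => f t * conj (g (t - x)) *
      Complex.exp (-2 * Real.pi * Complex.I * (⟪ω, t⟫_ℝ : ℂ))) (volume : Measure V) := by
  refine (integrable_mul_shift hf hg x).mul_bdd (c := 1)
    (by fun_prop) (Filter.Eventually.of_forall fun t => ?_)
  rw [Complex.norm_exp]
  simp

lemma stft_congr (g : V → ℂ) {f f' : V → ℂ} (h : f =ᵐ[volume] f') : stft g f = stft g f' := by
  funext x ω
  refine integral_congr_ae ?_
  filter_upwards [h] with t ht
  rw [ht]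

lemma stft_add {g f f' : V → ℂ} (hg : MemLp g 2 (volume : Measure V))
    (hf : MemLp f 2 (volume : Measure V)) (hf' : MemLp f' 2 (volume : Measure V)) :
    stft g (f + f') = stft g f + stft g f' := by
  funext x ω
  simp only [stft, Pi.add_apply, add_mul]
  exact integral_add (integrable_stft_integrand hf hg x ω) (integrable_stft_integrand hf' hg x ω)

lemma stft_smul (g f : V → ℂ) (c : ℂ) : stft g (c • f) = c • stft g f := by
  funext x ω
  simp only [stft, Pi.smul_apply, smul_eq_mul, mul_assoc]
  exact integral_const_mul _ _

/-- The Feichtinger algebra as a subspace of `L²(V)`: all `f ∈ L²(V)` with `V_φ f ∈ L¹(V × V)`. -/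
def feichtingerSubmodule (φ : Window V) : Submodule ℂ (Lp ℂ 2 (volume : Measure V)) where
  carrier := {f | Integrable (fun p : V × V => stft φ.toFun f p.1 p.2) volume}
  zero_mem' := by
    have h : stft φ.toFun (⇑(0 : Lp ℂ 2 (volume : Measure V))) = 0 := by
      rw [stft_congr _ (Lp.coeFn_zero ℂ 2 volume)]
      funext x ω
      simp [stft]
    simp only [Set.mem_ofPred_eq, h]
    exact integrable_zero _ _ _
  add_mem' := by
    intro a b ha hb
    simp only [Set.mem_ofPred_eq] at *
    rw [stft_congr _ (Lp.coeFn_add a b), stft_add φ.memLp_two (Lp.memLp a) (Lp.memLp b)]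
    exact ha.add hb
  smul_mem' := by
    intro c a ha
    simp only [Set.mem_ofPred_eq] at *
    rw [stft_congr _ (Lp.coeFn_smul c a), stft_smul]
    exact ha.smul c

/-- The Feichtinger algebra `S₀(V)`, defined with the window `φ`. It is a type of its own, so that
it carries the norm `‖V_φ f‖_{L¹}` and not the norm of `L²`. -/
def S0 (φ : Window V) : Type _ := feichtingerSubmodule φ

namespace S0

variable {φ : Window V}

instance : AddCommGroup (S0 φ) := inferInstanceAs (AddCommGroup (feichtingerSubmodule φ))

instance : Module ℂ (S0 φ) := inferInstanceAs (Module ℂ (feichtingerSubmodule φ))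

/-- The underlying element of `L²(V)`. -/
def toL2 (f : S0 φ) : Lp ℂ 2 (volume : Measure V) := Subtype.val (p := (· ∈ feichtingerSubmodule φ)) f

/-- Elements of `S₀(V)` are used as functions through a representative of the class in `L²(V)`. -/
instance : CoeFun (S0 φ) (fun _ => V → ℂ) := ⟨fun f => ⇑f.toL2⟩

lemma toL2_add (f h : S0 φ) : (f + h).toL2 = f.toL2 + h.toL2 := rfl

lemma toL2_smul (c : ℂ) (f : S0 φ) : (c • f).toL2 = c • f.toL2 := rfl

lemma toL2_injective : Function.Injective (toL2 (φ := φ)) := Subtype.val_injective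

lemma integrable_stft (f : S0 φ) :
    Integrable (fun p : V × V => stft φ.toFun f p.1 p.2) volume :=
  Subtype.property (p := (· ∈ feichtingerSubmodule φ)) f

/-- The map `f ↦ V_φ f` from `S₀(V)` to `L¹(V × V)`. -/
def stftL1 (φ : Window V) : S0 φ →ₗ[ℂ] Lp ℂ 1 (volume : Measure (V × V)) where
  toFun f := f.integrable_stft.toL1 _
  map_add' f h := by
    rw [← Integrable.toL1_add]
    congr 1
    funext p
    rw [toL2_add, stft_congr _ (Lp.coeFn_add f.toL2 h.toL2),
      stft_add φ.memLp_two (Lp.memLp f.toL2) (Lp.memLp h.toL2)]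
    rfl
  map_smul' c f := by
    rw [RingHom.id_apply, ← Integrable.toL1_smul]
    congr 1
    funext p
    rw [toL2_smul, stft_congr _ (Lp.coeFn_smul c f.toL2), stft_smul]
    rfl

end S0

lemma ae_eq_zero_of_fourier_eq_zero {u : V → ℂ} (hu : Integrable u volume) (h : 𝓕 u = 0) :
    ∀ᵐ t, u t = 0 := by
  refine ae_eq_zero_of_integral_contDiff_smul_eq_zero hu.locallyIntegrable fun χ hχ hχ' => ?_
  have hc : HasCompactSupport (fun x => (χ x : ℂ)) := hχ'.comp_left (g := fun r : ℝ => (r : ℂ)) rfl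
  have hs : ContDiff ℝ ((⊤ : ℕ∞) : WithTop ℕ∞) (fun x => (χ x : ℂ)) := Complex.ofRealCLM.contDiff.comp hχ
  let ψ : SchwartzMap V ℂ := 𝓕⁻ (hc.toSchwartzMap hs)
  have hψ : ∀ x, 𝓕 (ψ : V → ℂ) x = χ x := by
    intro x
    have h1 : 𝓕 ψ = hc.toSchwartzMap hs := fourier_fourierInv_eq _
    have h2 := congrArg (fun s : SchwartzMap V ℂ => s x) h1
    simp only [SchwartzMap.fourier_coe] at h2
    rw [h2]
    rfl
  have key := VectorFourier.integral_fourierIntegral_smul_eq_flip (e := Real.fourierChar)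
    (L := innerₗ V) (μ := (volume : Measure V)) (ν := (volume : Measure V)) (f := u)
    (g := (ψ : V → ℂ)) Real.continuous_fourierChar continuous_inner hu ψ.integrable
  have h0 : VectorFourier.fourierIntegral Real.fourierChar volume (innerₗ V) u = 0 := h
  rw [h0] at key
  rw [flip_innerₗ] at key
  simp only [Pi.zero_apply, zero_smul, integral_zero] at key
  rw [key]
  refine integral_congr_ae (Filter.Eventually.of_forall fun x => ?_)
  have := hψ x
  change χ x • u x = u x • 𝓕 (ψ : V → ℂ) x
  rw [this, Complex.real_smul, smul_eq_mul, mul_comm]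

lemma S0.stftL1_injective (φ : Window V) : Function.Injective (S0.stftL1 φ) := by
  rw [injective_iff_map_eq_zero]
  intro f hf
  apply S0.toL2_injective
  change f.toL2 = 0
  have h1 : (fun p : V × V => stft φ.toFun f p.1 p.2) =ᵐ[volume.prod volume] 0 :=
    (Integrable.toL1_eq_toL1_iff _ _ f.integrable_stft (integrable_zero _ _ _)).1
      (hf.trans (Integrable.toL1_zero _).symm)
  have h2 : ∀ᵐ x : V, ∀ᵐ t : V, f t * conj (φ.toFun (t - x)) = 0 := by
    filter_upwards [Measure.ae_ae_of_ae_prod h1] with x hx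
    have hi := integrable_mul_shift (Lp.memLp f.toL2) φ.memLp_two x
    refine ae_eq_zero_of_fourier_eq_zero hi ?_
    have hcont : Continuous (𝓕 (fun t => f t * conj (φ.toFun (t - x)))) :=
      VectorFourier.fourierIntegral_continuous Real.continuous_fourierChar continuous_inner hi
    refine (hcont.ae_eq_iff_eq volume continuous_const).1 ?_
    filter_upwards [hx] with ω hω
    rw [← stft_eq_fourier]
    exact hω
  have hmf : Measurable (fun p : V × V => f p.2 * conj (φ.toFun (p.2 - p.1))) := by
    have h3 : Measurable (f : V → ℂ) := (Lp.stronglyMeasurable f.toL2).measurable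
    have h4 : Measurable φ.toFun := φ.continuous.measurable
    have h5 : Measurable (fun p : V × V => φ.toFun (p.2 - p.1)) :=
      h4.comp (measurable_snd.sub measurable_fst)
    exact (h3.comp measurable_snd).mul (Complex.continuous_conj.measurable.comp h5)
  have h6 := (Measure.ae_ae_comm (μ := (volume : Measure V)) (ν := (volume : Measure V))
    (p := fun x t => f t * conj (φ.toFun (t - x)) = 0) (hmf (measurableSet_singleton 0))).1 h2
  refine (Lp.eq_zero_iff_ae_eq_zero).2 ?_
  filter_upwards [h6] with t ht
  by_contra hne
  apply φ.ne_zero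
  have h7 : (fun x => φ.toFun (t - x)) = fun _ => (0 : ℂ) := by
    refine (Continuous.ae_eq_iff_eq volume
      (φ.continuous.comp (continuous_const.sub continuous_id)) continuous_const).1 ?_
    filter_upwards [ht] with x hx
    have hne' : (f : V → ℂ) t ≠ 0 := hne
    rcases mul_eq_zero.1 hx with h | h
    · exact absurd h hne'
    · exact (map_eq_zero _).1 h
  funext y
  simpa using congrFun h7 (t - y)

/-- The norm of `S₀(V)` is `‖f‖ = ‖V_φ f‖_{L¹(V × V)}`, and the topology is that of this norm. -/
instance S0.instNormedAddCommGroup (φ : Window V) : NormedAddCommGroup (S0 φ) :=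
  NormedAddCommGroup.induced (S0 φ) (Lp ℂ 1 (volume : Measure (V × V))) (S0.stftL1 φ)
    (S0.stftL1_injective φ)

lemma S0.norm_def {φ : Window V} (f : S0 φ) :
    ‖f‖ = ∫ p : V × V, ‖stft φ.toFun f p.1 p.2‖ :=
  L1.norm_of_fun_eq_integral_norm f.integrable_stft

end General

/-- `ℝ^d`. -/
abbrev Space (d : ℕ) : Type := EuclideanSpace ℝ (Fin d)

/-- The phase space `ℝ^{2d} = ℝ^d × ℝ^d`, with its Euclidean structure. -/
abbrev PhaseSpace (d : ℕ) : Type := WithLp 2 (Space d × Space d)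

/-- The point `(x, ω)` of the phase space. -/
abbrev pt {d : ℕ} (x ω : Space d) : PhaseSpace d := WithLp.toLp 2 (x, ω)

/-- The integrand of the Gabor product at `(x, ω)`, as a function of `(x', ω', ω'')`. -/
def gaborIntegrand {d : ℕ} (g : Space d → ℂ) (F H : PhaseSpace d → ℂ) (x ω : Space d)
    (q : Space d × Space d × Space d) : ℂ :=
  conj (𝓕 g (q.2.1 + q.2.2 - ω)) * F (pt q.1 q.2.1) * H (pt q.1 q.2.2) *
    Complex.exp (2 * Complex.I * Real.pi * (⟪x, q.2.1 + q.2.2 - ω⟫_ℝ : ℂ))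

/-- The Gabor product
`(F ♮_g H)(x, ω) = ∫ conj(ĝ(ω' + ω'' - ω)) F(x', ω') H(x', ω'') e^{2πi x·(ω' + ω'' - ω)}`,
the integral being over `(x', ω', ω'') ∈ ℝ^{3d}`. -/
def gaborProduct {d : ℕ} (g : Space d → ℂ) (F H : PhaseSpace d → ℂ) (z : PhaseSpace d) : ℂ :=
  ∫ q, gaborIntegrand g F H z.fst z.snd q

/-- `Â_{F,H}(ξ) = ∫ F(x', ω') H(x', ξ - ω') dx' dω'`. -/
def auxHat {d : ℕ} (F H : PhaseSpace d → ℂ) (ξ : Space d) : ℂ :=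
  ∫ q : Space d × Space d, F (pt q.1 q.2) * H (pt q.1 (ξ - q.2))

/-- The auxiliary function `A_{F,H}`, the inverse Fourier transform of `Â_{F,H}`. -/
def aux {d : ℕ} (F H : PhaseSpace d → ℂ) : Space d → ℂ := 𝓕⁻ (auxHat F H)

end GaborProduct

end

set_option linter.unusedSectionVars false

noncomputable section

namespace GaborProduct

/-! The argument rests on an atomic description of `S₀`. By the inversion formula for the short-time
Fourier transform, every `f ∈ S₀` is a superposition `∫ a(p) M_η T_x ψ dp` with `a ∈ L¹`, and `ψ`
may be any nonzero exponentially localized function (`S0.exists_superpose`). Conversely, an `L¹`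
superposition of time-frequency shifts of one localized function, indexed by any s-finite measure
space, lies in `S₀`, with norm at most the `L¹` norm of the coefficients times a constant
(`S0.exists_eq_superpose`). Membership and norm bounds thus reduce to following atoms through the
formulas and estimating coefficients in `L¹`.

Only `H` is expanded, in shifts of `φ ⊗ φ`; of `F` nothing but integrability is needed. For fixed
`(x', ω')`, each atom of `H(x', ξ - ω')` is, as a function of `ξ`, a shift of `φ` times a bounded
factor, so `Â` is a superposition of shifts of `φ` with coefficients bounded in `L¹` by `‖F‖₁ ‖a‖₁`
up to a constant (`auxHat_eq_superpose`). The inverse Fourier transform exchanges position and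
frequency, so `A` is a superposition of shifts of `𝓕⁻ φ` (`aux_eq_superpose`).

The substitution `ω'' = ξ - ω'` and Fubini turn the Gabor product into `∫ Â(ξ) conj(ĝ(ξ - ω)) e^{2πi
x·(ξ - ω)} dξ`, which is `V_g (𝓕⁻ Â)` written on the Fourier side
(`gaborProduct_eq_integral_auxHat`, `stft_fourierInv`). Expanding `g` in shifts of `φ` as well,
covariance makes `V_g A` a superposition, on phase space, of shifts of the single function `V_φ (𝓕⁻
φ)` (`stftPhase_superpose`). That function is again localized (`ExpLocalized.stftPhase`), whence the
bound on `S₀(ℝ^{2d})`. Joint continuity follows because the product is biadditive and bounded. -/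

section TimeFrequency

variable {V : Type*} [NormedAddCommGroup V] [InnerProductSpace ℝ V] [FiniteDimensional ℝ V]
  [MeasurableSpace V] [BorelSpace V]

variable {Y : Type*} [MeasurableSpace Y] {μ : Measure Y} {m : Y → ℂ} {x η : Y → V} {γ : V → ℂ}

/-! ### Characters and Fourier conventions -/

/-- The character `r ↦ e^{2πir}`. -/
def phase (r : ℝ) : ℂ := Complex.exp (2 * Real.pi * Complex.I * r)

lemma norm_phase (r : ℝ) : ‖phase r‖ = 1 := by
  rw [phase, Complex.norm_exp]
  simp

lemma phase_zero : phase 0 = 1 := by simp [phase]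

lemma phase_add (r s : ℝ) : phase (r + s) = phase r * phase s := by
  rw [phase, phase, phase, ← Complex.exp_add]
  push_cast
  ring_nf

lemma conj_phase (r : ℝ) : conj (phase r) = phase (-r) := by
  rw [phase, phase, ← Complex.exp_conj]
  congr 1
  simp [Complex.conj_ofNat]

@[fun_prop]
lemma continuous_phase : Continuous phase := by
  unfold phase
  fun_prop

@[fun_prop]
lemma measurable_phase : Measurable phase := continuous_phase.measurable

lemma fourier_eq_phase (f : V → ℂ) (ω : V) : 𝓕 f ω = ∫ t, phase (-⟪t, ω⟫_ℝ) * f t := by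
  rw [Real.fourier_eq']
  refine integral_congr_ae (Filter.Eventually.of_forall fun t => ?_)
  simp only [smul_eq_mul, phase]
  congr 2
  push_cast
  ring

lemma fourierInv_eq_phase (f : V → ℂ) (t : V) : 𝓕⁻ f t = ∫ ω, phase ⟪ω, t⟫_ℝ * f ω := by
  rw [Real.fourierInv_eq']
  refine integral_congr_ae (Filter.Eventually.of_forall fun t => ?_)
  simp only [smul_eq_mul, phase]
  congr 2
  push_cast
  ring

lemma stft_eq_phase (g f : V → ℂ) (x ω : V) :
    stft g f x ω = ∫ t, f t * conj (g (t - x)) * phase (-⟪ω, t⟫_ℝ) := by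
  rw [stft]
  refine integral_congr_ae (Filter.Eventually.of_forall fun t => ?_)
  simp only [phase]
  congr 2
  push_cast
  ring

lemma norm_fourier_le (f : V → ℂ) (ω : V) : ‖𝓕 f ω‖ ≤ ∫ t, ‖f t‖ := by
  rw [fourier_eq_phase]
  refine (norm_integral_le_integral_norm _).trans_eq ?_
  simp [norm_phase]

lemma continuous_fourier {f : V → ℂ} (hf : Integrable f) : Continuous (𝓕 f) :=
  VectorFourier.fourierIntegral_continuous Real.continuous_fourierChar continuous_inner hf

lemma continuous_fourierInv {f : V → ℂ} (hf : Integrable f) : Continuous (𝓕⁻ f) := by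
  have h : 𝓕⁻ f = fun x => 𝓕 f (-x) := funext fun x => Real.fourierInv_eq_fourier_neg f x
  rw [h]
  exact (continuous_fourier hf).comp continuous_neg

/-! ### Exponential decay and localized functions -/

lemma integrable_exp_neg_mul_norm {h : ℝ} (hh : 0 < h) :
    Integrable (fun x : V => Real.exp (-h * ‖x‖)) := by
  set r : ℝ := Module.finrank ℝ V + 1 with hr
  have hr0 : 0 < r := by positivity
  have hInt : Integrable (fun x : V => (1 + ‖(h / r) • x‖) ^ (-r)) volume :=
    (integrable_one_add_norm (μ := (volume : Measure V))
      (show (Module.finrank ℝ V : ℝ) < r by rw [hr]; linarith)).comp_smul (by positivity)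
  refine hInt.mono' (by fun_prop) (Filter.Eventually.of_forall fun x => ?_)
  rw [Real.norm_of_nonneg (by positivity), norm_smul, Real.norm_of_nonneg (by positivity)]
  -- This is `1 + s ≤ exp s` at `s = h‖x‖/r`, raised to the power `r`; the choice `r = dim V + 1`
  -- makes the polynomial weight integrable.
  have h1 : (1 + h / r * ‖x‖) ^ r ≤ Real.exp (h * ‖x‖) := by
    calc (1 + h / r * ‖x‖) ^ r ≤ Real.exp (h / r * ‖x‖) ^ r :=
          Real.rpow_le_rpow (by positivity) (by linarith [Real.add_one_le_exp (h / r * ‖x‖)]) hr0.le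
      _ = Real.exp (h * ‖x‖) := by
          rw [← Real.exp_mul]
          congr 1
          field_simp
  rw [Real.rpow_neg (by positivity), neg_mul, Real.exp_neg]
  exact inv_anti₀ (by positivity) h1

/-- Exponential decay at some rate. -/
def ExpDecay (f : V → ℂ) : Prop :=
  ∃ h : ℝ, 0 < h ∧ ∃ C : ℝ, 0 ≤ C ∧ ∀ x, ‖f x‖ ≤ C * Real.exp (-h * ‖x‖)

lemma ExpDecay.bounded {f : V → ℂ} (hf : ExpDecay f) : ∃ C : ℝ, 0 ≤ C ∧ ∀ x, ‖f x‖ ≤ C := by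
  obtain ⟨h, hh, C, hC, H⟩ := hf
  refine ⟨C, hC, fun x => (H x).trans ?_⟩
  refine mul_le_of_le_one_right hC (Real.exp_le_one_iff.2 ?_)
  nlinarith [norm_nonneg x]

lemma ExpDecay.integrable {f : V → ℂ} (hf : ExpDecay f) (hc : Continuous f) : Integrable f := by
  obtain ⟨h, hh, C, -, H⟩ := hf
  exact ((integrable_exp_neg_mul_norm hh).const_mul C).mono' hc.aestronglyMeasurable
    (Filter.Eventually.of_forall H)

/-- The correlation of two exponentially decaying functions decays exponentially. -/
lemma ExpDecay.correlation {f g : V → ℂ} (hf : ExpDecay f) (hg : ExpDecay g) :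
    ∃ h : ℝ, 0 < h ∧ ∃ C : ℝ, 0 ≤ C ∧
      ∀ x, ∫ t, ‖f t‖ * ‖g (t - x)‖ ≤ C * Real.exp (-h * ‖x‖) := by
  obtain ⟨a, ha, A, hA, HA⟩ := hf
  obtain ⟨b, hb, B, hB, HB⟩ := hg
  -- Half of the decay of `f` is kept to integrate in `t`; the other half and the decay of `g` pay
  -- for `exp (-h‖x‖)` through `‖x‖ ≤ ‖t‖ + ‖t - x‖`.
  set h := min (a / 2) b with hh
  have h0 : 0 < h := lt_min (by positivity) hb
  have h1 : h ≤ a / 2 := min_le_left _ _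
  have h2 : h ≤ b := min_le_right _ _
  have hi := integrable_exp_neg_mul_norm (V := V) (half_pos ha)
  refine ⟨h, h0, A * B * ∫ t : V, Real.exp (-(a / 2) * ‖t‖), by positivity, fun x => ?_⟩
  have key : ∀ t, ‖f t‖ * ‖g (t - x)‖ ≤
      A * B * Real.exp (-h * ‖x‖) * Real.exp (-(a / 2) * ‖t‖) := by
    intro t
    have h3 : ‖x‖ ≤ ‖t‖ + ‖t - x‖ := by
      have := norm_sub_le t (t - x)
      rwa [sub_sub_cancel] at this
    calc ‖f t‖ * ‖g (t - x)‖ ≤ (A * Real.exp (-a * ‖t‖)) * (B * Real.exp (-b * ‖t - x‖)) :=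
          mul_le_mul (HA t) (HB _) (norm_nonneg _) (by positivity)
      _ = A * B * Real.exp (-a * ‖t‖ + -b * ‖t - x‖) := by rw [Real.exp_add]; ring
      _ ≤ A * B * Real.exp (-h * ‖x‖ + -(a / 2) * ‖t‖) := by
          refine mul_le_mul_of_nonneg_left (Real.exp_le_exp.2 ?_) (by positivity)
          nlinarith [norm_nonneg t, norm_nonneg (t - x), mul_le_mul_of_nonneg_left h3 h0.le,
            mul_le_mul_of_nonneg_right h1 (norm_nonneg t),
            mul_le_mul_of_nonneg_right h2 (norm_nonneg (t - x))]
      _ = _ := by rw [Real.exp_add]; ring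
  calc ∫ t, ‖f t‖ * ‖g (t - x)‖
      ≤ ∫ t : V, A * B * Real.exp (-h * ‖x‖) * Real.exp (-(a / 2) * ‖t‖) :=
        integral_mono_of_nonneg (Filter.Eventually.of_forall fun t => by positivity)
          (hi.const_mul _) (Filter.Eventually.of_forall key)
    _ = _ := by rw [integral_const_mul]; ring

/-- Continuous functions that, together with their Fourier transform, decay exponentially. -/
structure ExpLocalized (f : V → ℂ) : Prop where
  continuous : Continuous f
  decay : ExpDecay f
  decay_fourier : ExpDecay (𝓕 f)

namespace ExpLocalized

variable {f g : V → ℂ}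

lemma integrable (hf : ExpLocalized f) : Integrable f := hf.decay.integrable hf.continuous

lemma integrable_fourier (hf : ExpLocalized f) : Integrable (𝓕 f) :=
  hf.decay_fourier.integrable (continuous_fourier hf.integrable)

lemma fourierInv_fourier (hf : ExpLocalized f) : 𝓕⁻ (𝓕 f) = f :=
  hf.continuous.fourierInv_fourier_eq hf.integrable hf.integrable_fourier

protected lemma fourierInv (hf : ExpLocalized f) : ExpLocalized (𝓕⁻ f) where
  continuous := continuous_fourierInv hf.integrable
  decay := by
    obtain ⟨h, hh, C, hC, H⟩ := hf.decay_fourier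
    refine ⟨h, hh, C, hC, fun x => ?_⟩
    rw [Real.fourierInv_eq_fourier_neg]
    simpa using H (-x)
  decay_fourier := by
    rw [hf.continuous.fourier_fourierInv_eq hf.integrable hf.integrable_fourier]
    exact hf.decay

end ExpLocalized

/-- A single decay rate suffices for everything below. Working with this weaker class avoids
tracking smoothness and all rates when passing to inverse Fourier transforms, tensor products and
short-time Fourier transforms. -/
lemma Window.expLocalized (φ : Window V) : ExpLocalized φ.toFun := by
  have key : ∀ u : V → ℂ, (∃ C : ℝ, ∀ x, ‖u x‖ * Real.exp (1 * ‖x‖) ≤ C) → ExpDecay u := by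
    rintro u ⟨C, H⟩
    refine ⟨1, one_pos, C, le_trans (by positivity) (H 0), fun x => ?_⟩
    rw [neg_mul, Real.exp_neg, ← div_eq_mul_inv, le_div_iff₀ (Real.exp_pos _)]
    exact H x
  exact ⟨φ.continuous, key _ (φ.isGelfandShilov.decay 1 one_pos),
    key _ (φ.isGelfandShilov.decay_fourier 1 one_pos)⟩

/-- The short-time Fourier transform of an inverse Fourier transform, on the Fourier side. -/
lemma stft_fourierInv {g a : V → ℂ} (hg : Integrable g) (ha : Integrable a) (x ω : V) :
    stft g (𝓕⁻ a) x ω = ∫ ξ, a ξ * (conj (𝓕 g (ξ - ω)) * phase ⟪x, ξ - ω⟫_ℝ) := by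
  have hK : Integrable (fun p : V × V =>
      a p.2 * conj (g (p.1 - x)) * phase ⟪p.2 - ω, p.1⟫_ℝ) (volume.prod volume) := by
    have hg' : Integrable (fun t => conj (g (t - x))) :=
      (LinearIsometryEquiv.integrable_comp_iff Complex.conjLIE).2 (hg.comp_sub_right x)
    have h1 := hg'.mul_prod ha
    refine (h1.mul_bdd (c := 1) (g := fun p : V × V => phase ⟪p.2 - ω, p.1⟫_ℝ)
      (by fun_prop) (Filter.Eventually.of_forall fun p => (norm_phase _).le)).congr
      (Filter.Eventually.of_forall fun p => ?_)
    simp only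
    ring
  calc stft g (𝓕⁻ a) x ω
      = ∫ t, ∫ ξ, a ξ * conj (g (t - x)) * phase ⟪ξ - ω, t⟫_ℝ := by
        rw [stft_eq_phase]
        refine integral_congr_ae (Filter.Eventually.of_forall fun t => ?_)
        simp only
        rw [fourierInv_eq_phase, ← integral_mul_const, ← integral_mul_const]
        refine integral_congr_ae (Filter.Eventually.of_forall fun ξ => ?_)
        simp only
        rw [inner_sub_left, sub_eq_add_neg ⟪ξ, t⟫_ℝ, phase_add]
        ring
    _ = ∫ ξ, ∫ t, a ξ * conj (g (t - x)) * phase ⟪ξ - ω, t⟫_ℝ := integral_integral_swap hK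
    _ = _ := by
        refine integral_congr_ae (Filter.Eventually.of_forall fun ξ => ?_)
        simp only [mul_assoc]
        rw [integral_const_mul]
        congr 1
        -- Translating `t` by `x` removes the shift in `g` and releases the factor `phase ⟪x, ξ -
        -- ω⟫`.
        rw [← integral_add_right_eq_self _ x, fourier_eq_phase, ← integral_conj,
          ← integral_mul_const]
        refine integral_congr_ae (Filter.Eventually.of_forall fun t => ?_)
        simp only [add_sub_cancel_right, map_mul, conj_phase, neg_neg]
        rw [inner_add_right, phase_add, real_inner_comm t, real_inner_comm x]
        ring

namespace ExpLocalized

variable {f g : V → ℂ}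

/-- The short-time Fourier transform decays exponentially in both variables. -/
lemma stft_decay (hf : ExpLocalized f) (hg : ExpLocalized g) :
    ∃ h : ℝ, 0 < h ∧ ∃ C : ℝ, 0 ≤ C ∧
      ∀ x ω, ‖stft g f x ω‖ ≤ C * Real.exp (-h * (‖x‖ + ‖ω‖)) := by
  obtain ⟨a, ha, A, hA, HA⟩ := hf.decay.correlation hg.decay
  obtain ⟨b, hb, B, hB, HB⟩ := hf.decay_fourier.correlation hg.decay_fourier
  -- The defining integral is dominated by the correlation of `f` and `g`, which gives decay in `x`;
  -- the formula on the Fourier side is dominated by that of their transforms, which gives decay in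
  -- `ω`.
  have h1 : ∀ x ω, ‖stft g f x ω‖ ≤ A * Real.exp (-a * ‖x‖) := by
    intro x ω
    rw [stft_eq_phase]
    refine (norm_integral_le_integral_norm _).trans ((le_of_eq ?_).trans (HA x))
    simp [norm_phase]
  have h2 : ∀ x ω, ‖stft g f x ω‖ ≤ B * Real.exp (-b * ‖ω‖) := by
    intro x ω
    rw [← hf.fourierInv_fourier, stft_fourierInv hg.integrable hf.integrable_fourier]
    refine (norm_integral_le_integral_norm _).trans ((le_of_eq ?_).trans (HB ω))
    simp [norm_phase]
  -- Only the bound in the larger of `‖x‖`, `‖ω‖` is used; that variable is at least half of the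
  -- sum, which costs the factor `2`.
  set h := min a b / 2 with hh
  have h0 : 0 < h := half_pos (lt_min ha hb)
  have h3 : h ≤ a / 2 := by rw [hh]; linarith [min_le_left a b]
  have h4 : h ≤ b / 2 := by rw [hh]; linarith [min_le_right a b]
  refine ⟨h, h0, max A B, le_max_of_le_left hA, fun x ω => ?_⟩
  rcases le_total ‖x‖ ‖ω‖ with hx | hx
  · refine (h2 x ω).trans (mul_le_mul (le_max_right _ _) (Real.exp_le_exp.2 ?_)
      (Real.exp_pos _).le (le_max_of_le_left hA))
    nlinarith [norm_nonneg x, norm_nonneg ω]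
  · refine (h1 x ω).trans (mul_le_mul (le_max_left _ _) (Real.exp_le_exp.2 ?_)
      (Real.exp_pos _).le (le_max_of_le_left hA))
    nlinarith [norm_nonneg x, norm_nonneg ω]

end ExpLocalized

/-! ### Time-frequency shifts and their superpositions -/

/-- The time-frequency shift `M_η T_x γ`. -/
def tfShift (x η : V) (γ : V → ℂ) (t : V) : ℂ := phase ⟪η, t⟫_ℝ * γ (t - x)

lemma norm_tfShift (x η : V) (γ : V → ℂ) (t : V) : ‖tfShift x η γ t‖ = ‖γ (t - x)‖ := by
  rw [tfShift, norm_mul, norm_phase, one_mul]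

variable (μ m x η γ) in
/-- The superposition `∫ m(y) M_{η(y)} T_{x(y)} γ dμ(y)` of time-frequency shifts of `γ`. -/
def superpose (t : V) : ℂ := ∫ y, m y * tfShift (x y) (η y) γ t ∂μ

lemma measurable_tfShift_uncurry (hγ : Continuous γ) (hx : Measurable x) (hη : Measurable η) :
    Measurable (fun p : Y × V => tfShift (x p.1) (η p.1) γ p.2) := by
  have h1 : Measurable (fun p : Y × V => γ (p.2 - x p.1)) := hγ.measurable.comp (by fun_prop)
  have h2 : Measurable (fun p : Y × V => ⟪η p.1, p.2⟫_ℝ) :=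
    (hη.comp measurable_fst).inner measurable_snd
  exact (measurable_phase.comp h2).mul h1

lemma integrable_superpose_kernel [SFinite μ] (hγ : ExpLocalized γ) (hm : Integrable m μ)
    (hx : Measurable x) (hη : Measurable η) :
    Integrable (fun p : Y × V => m p.1 * tfShift (x p.1) (η p.1) γ p.2) (μ.prod volume) := by
  have hK : AEStronglyMeasurable (fun p : Y × V => m p.1 * tfShift (x p.1) (η p.1) γ p.2)
      (μ.prod volume) := hm.1.comp_fst.mul
    (measurable_tfShift_uncurry hγ.continuous hx hη).aestronglyMeasurable
  refine (integrable_prod_iff hK).2 ⟨?_, ?_⟩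
  · refine Filter.Eventually.of_forall fun y => ?_
    have h1 : Integrable (tfShift (x y) (η y) γ) :=
      (hγ.integrable.comp_sub_right (x y)).bdd_mul (c := 1) (by fun_prop)
        (Filter.Eventually.of_forall fun t => (norm_phase _).le)
    exact h1.const_mul (m y)
  · refine (hm.norm.mul_const (∫ t, ‖γ t‖)).congr (Filter.Eventually.of_forall fun y => ?_)
    simp only [norm_mul, norm_tfShift]
    rw [integral_const_mul, integral_sub_right_eq_self (fun t => ‖γ t‖)]

lemma integrable_superpose [SFinite μ] (hγ : ExpLocalized γ) (hm : Integrable m μ)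
    (hx : Measurable x) (hη : Measurable η) : Integrable (superpose μ m x η γ) :=
  (integrable_superpose_kernel hγ hm hx hη).integral_prod_right

lemma integral_norm_superpose_le [SFinite μ] (hγ : ExpLocalized γ) (hm : Integrable m μ)
    (hx : Measurable x) (hη : Measurable η) :
    ∫ t, ‖superpose μ m x η γ t‖ ≤ (∫ y, ‖m y‖ ∂μ) * ∫ t, ‖γ t‖ := by
  have hK := (integrable_superpose_kernel hγ hm hx hη).norm
  calc ∫ t, ‖superpose μ m x η γ t‖
      ≤ ∫ t, ∫ y, ‖m y * tfShift (x y) (η y) γ t‖ ∂μ :=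
        integral_mono (integrable_superpose hγ hm hx hη).norm hK.integral_prod_right
          fun t => norm_integral_le_integral_norm _
    _ = ∫ y, (∫ t, ‖m y * tfShift (x y) (η y) γ t‖) ∂μ := (integral_integral_swap hK).symm
    _ = _ := by
        rw [← integral_mul_const]
        refine integral_congr_ae (Filter.Eventually.of_forall fun y => ?_)
        simp only [norm_mul, norm_tfShift]
        rw [integral_const_mul, integral_sub_right_eq_self (fun t => ‖γ t‖)]

lemma continuous_superpose (hγ : ExpLocalized γ) (hm : Integrable m μ)
    (hx : Measurable x) (hη : Measurable η) : Continuous (superpose μ m x η γ) := by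
  obtain ⟨C, -, hC⟩ := hγ.decay.bounded
  refine continuous_of_dominated (bound := fun y => ‖m y‖ * C) (fun t => ?_) (fun t => ?_)
    (hm.norm.mul_const C) ?_
  · exact hm.1.mul ((measurable_tfShift_uncurry hγ.continuous hx hη).comp
      (measurable_id.prodMk measurable_const)).aestronglyMeasurable
  · refine Filter.Eventually.of_forall fun y => ?_
    rw [norm_mul, norm_tfShift]
    exact mul_le_mul_of_nonneg_left (hC _) (norm_nonneg _)
  · refine Filter.Eventually.of_forall fun y => ?_
    have := hγ.continuous
    unfold tfShift
    fun_prop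

lemma norm_superpose_le {C : ℝ} (hC : ∀ t, ‖γ t‖ ≤ C) (hm : Integrable m μ) (t : V) :
    ‖superpose μ m x η γ t‖ ≤ (∫ y, ‖m y‖ ∂μ) * C := by
  rw [superpose, ← integral_mul_const]
  refine norm_integral_le_of_norm_le (hm.norm.mul_const C) (Filter.Eventually.of_forall fun y => ?_)
  rw [norm_mul, norm_tfShift]
  exact mul_le_mul_of_nonneg_left (hC _) (norm_nonneg _)

/-- A superposition is both bounded and integrable, hence square integrable. -/
lemma memLp_two_superpose [SFinite μ] (hγ : ExpLocalized γ) (hm : Integrable m μ)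
    (hx : Measurable x) (hη : Measurable η) : MemLp (superpose μ m x η γ) 2 := by
  obtain ⟨C, -, hC⟩ := hγ.decay.bounded
  have hi := integrable_superpose hγ hm hx hη
  rw [memLp_two_iff_integrable_sq_norm hi.1]
  refine (hi.norm.bdd_mul (c := (∫ y, ‖m y‖ ∂μ) * C) hi.norm.1
    (Filter.Eventually.of_forall fun t => ?_)).congr
    (Filter.Eventually.of_forall fun t => (sq _).symm)
  rw [norm_norm]
  exact norm_superpose_le hC hm t

lemma fourierInv_tfShift (x η : V) (γ : V → ℂ) :
    𝓕⁻ (tfShift x η γ) = fun t => phase ⟪η, x⟫_ℝ * tfShift (-η) x (𝓕⁻ γ) t := by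
  funext t
  rw [fourierInv_eq_phase, tfShift, fourierInv_eq_phase, ← integral_add_right_eq_self _ x,
    ← integral_const_mul, ← integral_const_mul]
  refine integral_congr_ae (Filter.Eventually.of_forall fun s => ?_)
  simp only [tfShift, add_sub_cancel_right, sub_neg_eq_add, inner_add_left, inner_add_right,
    phase_add, real_inner_comm s η]
  ring

/-- Fubini reduces this to a single atom, where translation and modulation trade places. The
coefficients change only by a unimodular factor, so their `L¹` norm is unaffected. -/
lemma fourierInv_superpose [SFinite μ] (hγ : ExpLocalized γ) (hm : Integrable m μ)
    (hx : Measurable x) (hη : Measurable η) :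
    𝓕⁻ (superpose μ m x η γ) =
      superpose μ (fun y => m y * phase ⟪η y, x y⟫_ℝ) (fun y => -η y) x (𝓕⁻ γ) := by
  funext t
  have hK : Integrable (fun p : Y × V => phase ⟪p.2, t⟫_ℝ *
      (m p.1 * tfShift (x p.1) (η p.1) γ p.2)) (μ.prod volume) :=
    (integrable_superpose_kernel hγ hm hx hη).bdd_mul (c := 1) (by fun_prop)
      (Filter.Eventually.of_forall fun p => (norm_phase _).le)
  rw [fourierInv_eq_phase]
  simp only [superpose, ← integral_const_mul]
  rw [← integral_integral_swap hK]
  refine integral_congr_ae (Filter.Eventually.of_forall fun y => ?_)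
  have h := congrFun (fourierInv_tfShift (x y) (η y) γ) t
  rw [fourierInv_eq_phase] at h
  simp only [mul_assoc, ← h, ← integral_const_mul]
  refine integral_congr_ae (Filter.Eventually.of_forall fun s => ?_)
  simp only
  ring

lemma integrable_mul_phase (hm : Integrable m μ) {r : Y → ℝ} (hr : Measurable r) :
    Integrable (fun y => m y * phase (r y)) μ :=
  hm.mul_bdd (c := 1) (measurable_phase.comp hr).aestronglyMeasurable
    (Filter.Eventually.of_forall fun _ => (norm_phase _).le)

/-! ### Covariance of the short-time Fourier transform -/

/-- The short-time Fourier transform as a function on the phase space `V × V`. -/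
def stftPhase (g f : V → ℂ) (z : WithLp 2 (V × V)) : ℂ := stft g f z.fst z.snd

/-- Translating the integration variable by `x` leaves the transform of the unshifted pair at a
displaced point; `e2` sorts the remaining phases into a constant, a modulation in `z`, and the
kernel of the displaced transform. -/
lemma stftPhase_tfShift (x η v ν : V) (γ γ' : V → ℂ) (z : WithLp 2 (V × V)) :
    stftPhase (tfShift v ν γ') (tfShift x η γ) z =
      phase ⟪η - ν, x⟫_ℝ * tfShift (WithLp.toLp 2 (x - v, η - ν)) (WithLp.toLp 2 (ν, -x))
        (stftPhase γ' γ) z := by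
  rw [tfShift, stftPhase, stftPhase, stft_eq_phase, stft_eq_phase,
    ← integral_add_right_eq_self _ x, ← integral_const_mul, ← integral_const_mul]
  refine integral_congr_ae (Filter.Eventually.of_forall fun s => ?_)
  simp only [tfShift, add_sub_cancel_right, map_mul, conj_phase, WithLp.prod_inner_apply,
    WithLp.sub_fst, WithLp.sub_snd]
  have e1 : s + x - z.fst - v = s - (z.fst - (x - v)) := by abel
  rw [e1]
  have e2 : phase ⟪η, s + x⟫_ℝ * phase (-⟪ν, s + x - z.fst⟫_ℝ) * phase (-⟪z.snd, s + x⟫_ℝ) =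
      phase ⟪η - ν, x⟫_ℝ * phase (⟪ν, z.fst⟫_ℝ + ⟪-x, z.snd⟫_ℝ) *
        phase (-⟪z.snd - (η - ν), s⟫_ℝ) := by
    simp only [← phase_add]
    congr 1
    simp only [inner_add_right, inner_sub_left, inner_sub_right, inner_neg_left,
      real_inner_comm x z.snd]
    ring
  change _ = phase ⟪η - ν, x⟫_ℝ * (phase (⟪ν, z.fst⟫_ℝ + ⟪-x, z.snd⟫_ℝ) *
    (γ s * conj (γ' (s - (z.fst - (x - v)))) * phase (-⟪z.snd - (η - ν), s⟫_ℝ)))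
  linear_combination (γ s * conj (γ' (s - (z.fst - (x - v))))) * e2

/-- Sesquilinearity and Fubini reduce to pairs of atoms, hence the product index space; covariance
handles each pair. -/
lemma stftPhase_superpose [SFinite μ] {Y' : Type*} [MeasurableSpace Y'] {μ' : Measure Y'}
    [SFinite μ'] {b : Y' → ℂ} {v ν : Y' → V} {γ' : V → ℂ}
    (hγ : ExpLocalized γ) (hm : Integrable m μ) (hx : Measurable x) (hη : Measurable η)
    (hγ' : ExpLocalized γ') (hb : Integrable b μ') (hv : Measurable v) (hν : Measurable ν) :
    stftPhase (superpose μ' b v ν γ') (superpose μ m x η γ) =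
      superpose (μ.prod μ')
        (fun p => m p.1 * conj (b p.2) * phase ⟪η p.1 - ν p.2, x p.1⟫_ℝ)
        (fun p => WithLp.toLp 2 (x p.1 - v p.2, η p.1 - ν p.2))
        (fun p => WithLp.toLp 2 (ν p.2, -x p.1)) (stftPhase γ' γ) := by
  funext z
  obtain ⟨C, -, hC⟩ := hγ'.decay.bounded
  have hb' : Integrable (fun y => conj (b y)) μ' :=
    (LinearIsometryEquiv.integrable_comp_iff Complex.conjLIE).2 hb
  have hK : Integrable (fun p : (Y × Y') × V =>
      m p.1.1 * conj (b p.1.2) * tfShift (x p.1.1) (η p.1.1) γ p.2 *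
        (conj (tfShift (v p.1.2) (ν p.1.2) γ' (p.2 - z.fst)) * phase (-⟪z.snd, p.2⟫_ℝ)))
      ((μ.prod μ').prod volume) := by
    refine (integrable_superpose_kernel hγ (hm.mul_prod hb') (hx.comp measurable_fst)
      (hη.comp measurable_fst)).mul_bdd (c := C) ?_ (Filter.Eventually.of_forall fun p => ?_)
    · have h1 : Measurable (fun p : (Y × Y') × V =>
          tfShift (v p.1.2) (ν p.1.2) γ' (p.2 - z.fst)) :=
        (measurable_tfShift_uncurry hγ'.continuous hv hν).comp
          ((measurable_snd.comp measurable_fst).prodMk (measurable_snd.sub measurable_const))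
      exact ((Complex.continuous_conj.measurable.comp h1).mul (by fun_prop)).aestronglyMeasurable
    · rw [norm_mul, norm_phase, mul_one, RCLike.norm_conj, norm_tfShift]
      exact hC _
  rw [stftPhase, stft_eq_phase]
  calc ∫ t, superpose μ m x η γ t * conj (superpose μ' b v ν γ' (t - z.fst)) *
          phase (-⟪z.snd, t⟫_ℝ)
      = ∫ t, ∫ p : Y × Y', m p.1 * conj (b p.2) * tfShift (x p.1) (η p.1) γ t *
        (conj (tfShift (v p.2) (ν p.2) γ' (t - z.fst)) * phase (-⟪z.snd, t⟫_ℝ)) ∂(μ.prod μ') := by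
        refine integral_congr_ae (Filter.Eventually.of_forall fun t => ?_)
        simp only [superpose]
        rw [← integral_conj, ← integral_prod_mul, ← integral_mul_const]
        refine integral_congr_ae (Filter.Eventually.of_forall fun p => ?_)
        simp only [map_mul]
        ring
    _ = ∫ p : Y × Y', (∫ t, m p.1 * conj (b p.2) * tfShift (x p.1) (η p.1) γ t *
        (conj (tfShift (v p.2) (ν p.2) γ' (t - z.fst)) * phase (-⟪z.snd, t⟫_ℝ))) ∂(μ.prod μ') :=
        (integral_integral_swap hK).symm
    _ = _ := by
        rw [superpose]
        refine integral_congr_ae (Filter.Eventually.of_forall fun p => ?_)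
        simp only [mul_assoc]
        rw [← stftPhase_tfShift, stftPhase, stft_eq_phase]
        simp only [← integral_const_mul, mul_assoc]

/-- A single function is a superposition with one atom, so results about superpositions apply to it.
-/
lemma superpose_dirac (ψ : V → ℂ) :
    superpose (Measure.dirac ()) (fun _ => 1) (fun _ => 0) (fun _ => 0) ψ = ψ := by
  funext t
  simp [superpose, tfShift, phase_zero]

/-! ### Localization on phase space -/

lemma ExpDecay.of_fst_snd {G : WithLp 2 (V × V) → ℂ} {h C : ℝ} (hh : 0 < h) (hC : 0 ≤ C)
    (H : ∀ z, ‖G z‖ ≤ C * Real.exp (-h * (‖z.fst‖ + ‖z.snd‖))) : ExpDecay G := by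
  refine ⟨h, hh, C, hC, fun z => (H z).trans ?_⟩
  refine mul_le_mul_of_nonneg_left (Real.exp_le_exp.2 ?_) hC
  have h1 : ‖z‖ ≤ ‖z.fst‖ + ‖z.snd‖ := by
    rw [WithLp.prod_norm_eq_of_L2]
    refine Real.sqrt_le_iff.2 ⟨by positivity, ?_⟩
    nlinarith [norm_nonneg z.fst, norm_nonneg z.snd]
  nlinarith

lemma ExpDecay.of_mul {G : WithLp 2 (V × V) → ℂ} {u v : V → ℂ} (hu : ExpDecay u)
    (hv : ExpDecay v) (H : ∀ z, ‖G z‖ ≤ ‖u z.fst‖ * ‖v z.snd‖) : ExpDecay G := by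
  obtain ⟨a, ha, A, hA, HA⟩ := hu
  obtain ⟨b, hb, B, hB, HB⟩ := hv
  refine ExpDecay.of_fst_snd (h := min a b) (C := A * B) (lt_min ha hb) (by positivity)
    fun z => ?_
  calc ‖G z‖ ≤ (A * Real.exp (-a * ‖z.fst‖)) * (B * Real.exp (-b * ‖z.snd‖)) :=
        (H z).trans (mul_le_mul (HA _) (HB _) (norm_nonneg _) (by positivity))
    _ = A * B * Real.exp (-a * ‖z.fst‖ + -b * ‖z.snd‖) := by rw [Real.exp_add]; ring
    _ ≤ _ := by
        refine mul_le_mul_of_nonneg_left (Real.exp_le_exp.2 ?_) (by positivity)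
        nlinarith [norm_nonneg z.fst, norm_nonneg z.snd, min_le_left a b, min_le_right a b,
          mul_le_mul_of_nonneg_right (min_le_left a b) (norm_nonneg z.fst),
          mul_le_mul_of_nonneg_right (min_le_right a b) (norm_nonneg z.snd)]

lemma integrable_comp_toLp_iff {G : WithLp 2 (V × V) → ℂ} :
    Integrable (fun p : V × V => G (WithLp.toLp 2 p)) ↔ Integrable G :=
  (WithLp.volume_preserving_toLp V V).integrable_comp_emb
    (MeasurableEquiv.toLp 2 (V × V)).measurableEmbedding

lemma integral_comp_toLp {E : Type*} [NormedAddCommGroup E] [NormedSpace ℝ E]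
    (G : WithLp 2 (V × V) → E) : ∫ p : V × V, G (WithLp.toLp 2 p) = ∫ z, G z :=
  (WithLp.volume_preserving_toLp V V).integral_comp
    (MeasurableEquiv.toLp 2 (V × V)).measurableEmbedding G

lemma fourier_phaseSpace (G : WithLp 2 (V × V) → ℂ) (ζ : WithLp 2 (V × V)) :
    𝓕 G ζ = ∫ p : V × V, phase (-⟪p.1, ζ.fst⟫_ℝ) * phase (-⟪p.2, ζ.snd⟫_ℝ) *
      G (WithLp.toLp 2 p) := by
  rw [fourier_eq_phase, ← integral_comp_toLp]
  refine integral_congr_ae (Filter.Eventually.of_forall fun p => ?_)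
  simp only [WithLp.prod_inner_apply]
  rw [neg_add, phase_add]
  rfl

/-- The tensor product of two functions, as a function on the phase space. -/
def tensor (u v : V → ℂ) (z : WithLp 2 (V × V)) : ℂ := u z.fst * v z.snd

lemma ExpLocalized.tensor {u v : V → ℂ} (hu : ExpLocalized u) (hv : ExpLocalized v) :
    ExpLocalized (tensor u v) where
  continuous := by
    have h1 := hu.continuous
    have h2 := hv.continuous
    unfold GaborProduct.tensor
    fun_prop
  decay := ExpDecay.of_mul hu.decay hv.decay fun z => (norm_mul _ _).le
  decay_fourier := by
    refine ExpDecay.of_mul hu.decay_fourier hv.decay_fourier fun ζ => le_of_eq ?_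
    rw [← norm_mul, fourier_phaseSpace, fourier_eq_phase u, fourier_eq_phase v,
      ← integral_prod_mul]
    congr 1
    refine integral_congr_ae (Filter.Eventually.of_forall fun p => ?_)
    change phase (-⟪p.1, ζ.fst⟫_ℝ) * phase (-⟪p.2, ζ.snd⟫_ℝ) * (u p.1 * v p.2) = _
    ring

lemma ExpLocalized.integrable_mul_shift {f g : V → ℂ} (hf : ExpLocalized f) (hg : ExpLocalized g)
    (x : V) : Integrable (fun t => f t * conj (g (t - x))) := by
  obtain ⟨C, -, hC⟩ := hg.decay.bounded
  have := hg.continuous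
  refine hf.integrable.mul_bdd (c := C) (by fun_prop) (Filter.Eventually.of_forall fun t => ?_)
  rw [RCLike.norm_conj]
  exact hC _

/-- The phase-space Fourier transform of `V_g f` at `(ζ₁, ζ₂)` has modulus `|ĝ(ζ₁)| |f(-ζ₂)|`, so
its decay comes from that of `ĝ` and `f`. -/
lemma ExpLocalized.stftPhase {f g : V → ℂ} (hf : ExpLocalized f) (hg : ExpLocalized g) :
    ExpLocalized (stftPhase g f) := by
  obtain ⟨C, -, hC⟩ := hg.decay.bounded
  have hcf := hf.continuous
  have hcg := hg.continuous
  have hcont : Continuous (GaborProduct.stftPhase g f) := by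
    have h : GaborProduct.stftPhase g f = fun z : WithLp 2 (V × V) =>
        ∫ t, f t * conj (g (t - z.fst)) * phase (-⟪z.snd, t⟫_ℝ) :=
      funext fun z => stft_eq_phase _ _ _ _
    rw [h]
    refine continuous_of_dominated (bound := fun t => ‖f t‖ * C) (fun z => ?_) (fun z => ?_)
      (hf.integrable.norm.mul_const C) ?_
    · exact Continuous.aestronglyMeasurable (by fun_prop)
    · refine Filter.Eventually.of_forall fun t => ?_
      rw [norm_mul, norm_phase, mul_one, norm_mul, RCLike.norm_conj]
      exact mul_le_mul_of_nonneg_left (hC _) (norm_nonneg _)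
    · exact Filter.Eventually.of_forall fun t => by fun_prop
  obtain ⟨h, hh, D, hD, HD⟩ := hf.stft_decay hg
  have hdecay : ExpDecay (GaborProduct.stftPhase g f) :=
    ExpDecay.of_fst_snd hh hD fun z => HD z.fst z.snd
  have hInt := hdecay.integrable hcont
  refine ⟨hcont, hdecay, ?_⟩
  have hfneg : ExpDecay (fun t => f (-t)) := by
    obtain ⟨a, ha, A, hA, HA⟩ := hf.decay
    exact ⟨a, ha, A, hA, fun t => by simpa using HA (-t)⟩
  refine ExpDecay.of_mul hg.decay_fourier hfneg fun ζ => le_of_eq ?_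
  -- Fourier inversion for `t ↦ f(t) conj(g(t - x))`, evaluated at `-ζ.snd`.
  have hinner : ∀ x : V, ∫ ω, phase (-⟪ω, ζ.snd⟫_ℝ) * stft g f x ω =
      f (-ζ.snd) * conj (g (-ζ.snd - x)) := by
    intro x
    have hu := hf.integrable_mul_shift hg x
    have hu' : 𝓕 (fun t => f t * conj (g (t - x))) = stft g f x :=
      funext fun ω => (stft_eq_fourier g f x ω).symm
    have hi : Integrable (stft g f x) := by
      rw [← hu']
      refine ((integrable_exp_neg_mul_norm hh).const_mul D).mono'
        (continuous_fourier hu).aestronglyMeasurable (Filter.Eventually.of_forall fun ω => ?_)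
      rw [hu']
      refine (HD x ω).trans (mul_le_mul_of_nonneg_left (Real.exp_le_exp.2 ?_) hD)
      nlinarith [norm_nonneg x]
    have h1 := congrFun (Continuous.fourierInv_fourier_eq (f := fun t => f t * conj (g (t - x)))
      (by fun_prop) hu (hu'.symm ▸ hi)) (-ζ.snd)
    rw [hu', fourierInv_eq_phase] at h1
    simpa only [inner_neg_right] using h1
  have hprod : Integrable (fun p : V × V => phase (-⟪p.1, ζ.fst⟫_ℝ) * phase (-⟪p.2, ζ.snd⟫_ℝ) *
      GaborProduct.stftPhase g f (WithLp.toLp 2 p)) (volume.prod volume) := by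
    refine (integrable_comp_toLp_iff.2 hInt).bdd_mul (c := 1) (by fun_prop)
      (Filter.Eventually.of_forall fun p => ?_)
    rw [norm_mul, norm_phase, norm_phase, one_mul]
  have hF : 𝓕 (GaborProduct.stftPhase g f) ζ =
      f (-ζ.snd) * ∫ x, phase (-⟪x, ζ.fst⟫_ℝ) * conj (g (-ζ.snd - x)) := by
    rw [fourier_phaseSpace, Measure.volume_eq_prod, integral_prod _ hprod, ← integral_const_mul]
    refine integral_congr_ae (Filter.Eventually.of_forall fun x => ?_)
    simp only [mul_assoc]
    rw [integral_const_mul]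
    change phase (-⟪x, ζ.fst⟫_ℝ) * (∫ ω, phase (-⟪ω, ζ.snd⟫_ℝ) * stft g f x ω) = _
    rw [hinner x]
    ring
  have hG : ∫ x, phase (-⟪x, ζ.fst⟫_ℝ) * conj (g (-ζ.snd - x)) =
      phase ⟪ζ.snd, ζ.fst⟫_ℝ * conj (𝓕 g ζ.fst) := by
    rw [← integral_sub_left_eq_self _ _ (-ζ.snd), fourier_eq_phase, ← integral_conj,
      ← integral_const_mul]
    refine integral_congr_ae (Filter.Eventually.of_forall fun s => ?_)
    simp only [sub_sub_cancel, map_mul, conj_phase, ← mul_assoc, ← phase_add]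
    congr 2
    simp only [inner_sub_left, inner_neg_left]
    ring
  rw [hF, hG, norm_mul, norm_mul, norm_phase, RCLike.norm_conj]
  ring

/-! ### Atomic decomposition of `S₀` -/

lemma integrable_stft_superpose [SFinite μ] {ψ : V → ℂ} (hψ : ExpLocalized ψ)
    (hγ : ExpLocalized γ) (hm : Integrable m μ) (hx : Measurable x) (hη : Measurable η) :
    Integrable (fun p : V × V => stft ψ (superpose μ m x η γ) p.1 p.2) ∧
      ∫ p : V × V, ‖stft ψ (superpose μ m x η γ) p.1 p.2‖ ≤
        (∫ y, ‖m y‖ ∂μ) * ∫ z, ‖stftPhase ψ γ z‖ := by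
  -- With the window as a one-atom superposition, the transform is itself a superposition of shifts
  -- of `V_ψ γ`, and the general `L¹` bound applies.
  have h1 := stftPhase_superpose hγ hm hx hη hψ (μ' := Measure.dirac ()) (b := fun _ => 1)
    (v := fun _ => 0) (ν := fun _ => 0) (integrable_const _) measurable_const measurable_const
  rw [superpose_dirac] at h1
  have hm' : Integrable (fun p : Y × Unit => m p.1 * conj (1 : ℂ) *
      phase ⟪η p.1 - (0 : V), x p.1⟫_ℝ) (μ.prod (Measure.dirac ())) := by
    refine integrable_mul_phase (m := fun p : Y × Unit => m p.1 * conj (1 : ℂ)) ?_ ?_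
    · exact hm.mul_prod (integrable_const (μ := Measure.dirac ()) (conj (1 : ℂ)))
    · exact ((hη.comp measurable_fst).sub measurable_const).inner (hx.comp measurable_fst)
  have hX : Measurable (fun p : Y × Unit =>
      (WithLp.toLp 2 (x p.1 - (0 : V), η p.1 - (0 : V)) : WithLp 2 (V × V))) :=
    (MeasurableEquiv.toLp 2 (V × V)).measurable.comp (by fun_prop)
  have hN : Measurable (fun p : Y × Unit =>
      (WithLp.toLp 2 ((0 : V), -x p.1) : WithLp 2 (V × V))) :=
    (MeasurableEquiv.toLp 2 (V × V)).measurable.comp (by fun_prop)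
  have h2 := integrable_superpose (hγ.stftPhase hψ) hm' hX hN
  have h3 := integral_norm_superpose_le (hγ.stftPhase hψ) hm' hX hN
  rw [← h1] at h2 h3
  refine ⟨integrable_comp_toLp_iff.2 h2, ?_⟩
  have h4 := integral_comp_toLp (V := V) (fun z => ‖stftPhase ψ (superpose μ m x η γ) z‖)
  refine (h4.le.trans h3).trans_eq ?_
  congr 1
  rw [integral_prod _ hm'.norm]
  simp [norm_phase]

/-- Without continuity of `u`, inversion is proved by duality: against a test function `θ = 𝓕 ψ`,
one has `∫ 𝓕⁻(𝓕 u) θ = ∫ 𝓕 u · ψ = ∫ u θ`. -/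
lemma ae_eq_fourierInv_fourier {u : V → ℂ} (hu : Integrable u) (hu' : Integrable (𝓕 u)) :
    u =ᵐ[volume] 𝓕⁻ (𝓕 u) := by
  have hv := (continuous_fourierInv hu').locallyIntegrable (μ := (volume : Measure V))
  have key : ∀ᵐ t, (u - 𝓕⁻ (𝓕 u)) t = 0 := by
    refine ae_eq_zero_of_integral_contDiff_smul_eq_zero (hu.locallyIntegrable.sub hv)
      fun χ hχ hχ' => ?_
    have hc : HasCompactSupport (fun x => (χ x : ℂ)) :=
      hχ'.comp_left (g := fun r : ℝ => (r : ℂ)) rfl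
    have hs : ContDiff ℝ ((⊤ : ℕ∞) : WithTop ℕ∞) (fun x => (χ x : ℂ)) :=
      Complex.ofRealCLM.contDiff.comp hχ
    let θ : SchwartzMap V ℂ := hc.toSchwartzMap hs
    let ψ : SchwartzMap V ℂ := 𝓕⁻ θ
    have hψ : 𝓕 (ψ : V → ℂ) = θ := by
      have h1 : 𝓕 ψ = θ := fourier_fourierInv_eq _
      rw [← SchwartzMap.fourier_coe, h1]
    have hψ' : 𝓕⁻ (θ : V → ℂ) = ψ := (SchwartzMap.fourierInv_coe θ).symm
    have k1 := VectorFourier.integral_fourierIntegral_smul_eq_flip (e := Real.fourierChar)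
      (L := innerₗ V) (μ := (volume : Measure V)) (ν := (volume : Measure V)) (f := u)
      (g := (ψ : V → ℂ)) Real.continuous_fourierChar continuous_inner hu ψ.integrable
    rw [flip_innerₗ] at k1
    -- The pairing `-innerₗ V` turns the Fourier integral into the inverse transform.
    have k2 := VectorFourier.integral_fourierIntegral_smul_eq_flip (e := Real.fourierChar)
      (L := -innerₗ V) (μ := (volume : Measure V)) (ν := (volume : Measure V)) (f := 𝓕 u)
      (g := (θ : V → ℂ)) Real.continuous_fourierChar continuous_inner.neg hu' θ.integrable
    have hflip : (-innerₗ V).flip = -innerₗ V := by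
      ext a b
      simp [real_inner_comm]
    rw [hflip] at k2
    change ∫ ξ, 𝓕 u ξ • ψ ξ = ∫ t, u t • 𝓕 (ψ : V → ℂ) t at k1
    change ∫ ξ, 𝓕⁻ (𝓕 u) ξ • θ ξ = ∫ t, 𝓕 u t • 𝓕⁻ (θ : V → ℂ) t at k2
    rw [hψ] at k1
    rw [hψ', k1] at k2
    have i1 : Integrable (fun t => χ t • u t) :=
      hu.locallyIntegrable.integrable_smul_left_of_hasCompactSupport hχ.continuous hχ'
    have i2 : Integrable (fun t => χ t • 𝓕⁻ (𝓕 u) t) :=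
      hv.integrable_smul_left_of_hasCompactSupport hχ.continuous hχ'
    simp only [Pi.sub_apply, smul_sub]
    rw [integral_sub i1 i2, sub_eq_zero]
    convert! k2.symm using 1
    all_goals
      refine integral_congr_ae (Filter.Eventually.of_forall fun t => ?_)
      change (χ t : ℝ) • _ = _ • (χ t : ℂ)
      rw [Complex.real_smul, smul_eq_mul, mul_comm]
  filter_upwards [key] with t ht
  exact sub_eq_zero.1 ht

lemma ExpLocalized.memLp_two {φ : V → ℂ} (hφ : ExpLocalized φ) : MemLp φ 2 := by
  have h := memLp_two_superpose (μ := Measure.dirac ()) (m := fun _ => 1) (x := fun _ => 0)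
    (η := fun _ => 0) hφ (integrable_const _) measurable_const measurable_const
  rwa [superpose_dirac] at h

lemma measurable_stft {f φ : V → ℂ} (hf : Measurable f) (hφ : Measurable φ) :
    Measurable (fun p : V × V => stft φ f p.1 p.2) := by
  simp only [stft_eq_phase]
  refine (StronglyMeasurable.integral_prod_right' (f := fun q : (V × V) × V =>
    f q.2 * conj (φ (q.2 - q.1.1)) * phase (-⟪q.1.2, q.2⟫_ℝ)) ?_).measurable
  have h1 : Measurable (fun q : (V × V) × V => conj (φ (q.2 - q.1.1))) :=
    Complex.continuous_conj.measurable.comp (hφ.comp (by fun_prop))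
  have h2 : Measurable (fun q : (V × V) × V => ⟪q.1.2, q.2⟫_ℝ) := by fun_prop
  exact (((hf.comp measurable_snd).mul h1).mul (measurable_phase.comp h2.neg)).stronglyMeasurable

/-- The inversion formula for the short-time Fourier transform. -/
lemma mul_integral_sq_eq_superpose {f φ : V → ℂ} (hfm : Measurable f) (hf : MemLp f 2)
    (hφ : ExpLocalized φ) (hi : Integrable (fun p : V × V => stft φ f p.1 p.2)) :
    ∀ᵐ t, f t * ((∫ s, ‖φ s‖ ^ 2 : ℝ) : ℂ) =
      superpose volume (fun p : V × V => stft φ f p.1 p.2) Prod.fst Prod.snd φ t := by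
  have hφc := hφ.continuous
  have h1 : ∀ᵐ x : V, ∀ᵐ t : V,
      f t * conj (φ (t - x)) = ∫ ω, phase ⟪ω, t⟫_ℝ * stft φ f x ω := by
    filter_upwards [Integrable.prod_right_ae (f := fun p : V × V => stft φ f p.1 p.2) hi] with x hx
    have hu := GaborProduct.integrable_mul_shift hf hφ.memLp_two x
    have hu' : 𝓕 (fun t => f t * conj (φ (t - x))) = stft φ f x :=
      funext fun ω => (stft_eq_fourier φ f x ω).symm
    have h := ae_eq_fourierInv_fourier hu (hu'.symm ▸ hx)
    rw [hu'] at h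
    filter_upwards [h] with t ht
    rw [ht, fourierInv_eq_phase]
  have hm1 : Measurable (fun p : V × V => f p.2 * conj (φ (p.2 - p.1))) := by
    have h4 : Measurable φ := hφc.measurable
    have h5 : Measurable (fun p : V × V => φ (p.2 - p.1)) := h4.comp (by fun_prop)
    exact (hfm.comp measurable_snd).mul (Complex.continuous_conj.measurable.comp h5)
  have hm2 : Measurable (fun p : V × V => ∫ ω, phase ⟪ω, p.2⟫_ℝ * stft φ f p.1 ω) := by
    refine (StronglyMeasurable.integral_prod_right' (f := fun q : (V × V) × V =>
      phase ⟪q.2, q.1.2⟫_ℝ * stft φ f q.1.1 q.2) ?_).measurable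
    have h2 : Measurable (fun q : (V × V) × V => ⟪q.2, q.1.2⟫_ℝ) := by fun_prop
    have h3 : Measurable (fun q : (V × V) × V => stft φ f q.1.1 q.2) :=
      (measurable_stft hfm hφc.measurable).comp
        ((measurable_fst.comp measurable_fst).prodMk measurable_snd)
    exact ((measurable_phase.comp h2).mul h3).stronglyMeasurable
  -- Inversion on slices holds for almost every `x`, then almost every `t`; the next step fixes `t`
  -- and integrates over `x`, so the quantifiers must be exchanged.
  have h2 := (Measure.ae_ae_comm (μ := (volume : Measure V)) (ν := (volume : Measure V))
    (p := fun x t => f t * conj (φ (t - x)) = ∫ ω, phase ⟪ω, t⟫_ℝ * stft φ f x ω)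
    (measurableSet_eq_fun hm1 hm2)).1 h1
  obtain ⟨C, -, hC⟩ := hφ.decay.bounded
  filter_upwards [h2] with t ht
  have hprod : Integrable (fun p : V × V => stft φ f p.1 p.2 * tfShift p.1 p.2 φ t)
      (volume.prod volume) := by
    refine hi.mul_bdd (c := C) ?_ (Filter.Eventually.of_forall fun p => ?_)
    · unfold tfShift
      exact Continuous.aestronglyMeasurable (by fun_prop)
    · rw [norm_tfShift]
      exact hC _
  rw [superpose, Measure.volume_eq_prod, integral_prod _ hprod]
  -- Multiplying the slice identity by `φ (t - x)` and integrating in `x` produces the constant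
  -- `‖φ‖₂²`.
  calc f t * ((∫ s, ‖φ s‖ ^ 2 : ℝ) : ℂ) = ∫ x, f t * conj (φ (t - x)) * φ (t - x) := by
        rw [← integral_sub_left_eq_self (fun s => ‖φ s‖ ^ 2) _ t, ← integral_complex_ofReal,
          ← integral_const_mul]
        refine integral_congr_ae (Filter.Eventually.of_forall fun x => ?_)
        simp only
        rw [mul_assoc, mul_comm (conj _), Complex.mul_conj, Complex.normSq_eq_norm_sq]
    _ = _ := by
        refine integral_congr_ae ?_
        filter_upwards [ht] with x hx
        rw [hx, ← integral_mul_const]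
        refine integral_congr_ae (Filter.Eventually.of_forall fun ω => ?_)
        simp only [tfShift]
        ring

lemma ExpLocalized.integral_sq_ne_zero {φ : V → ℂ} (hφ : ExpLocalized φ) (h0 : φ ≠ 0) :
    ∫ s, ‖φ s‖ ^ 2 ≠ 0 := by
  intro h
  apply h0
  rw [integral_eq_zero_iff_of_nonneg (fun s => by positivity)
    ((memLp_two_iff_integrable_sq_norm hφ.continuous.aestronglyMeasurable).1 hφ.memLp_two)] at h
  refine (hφ.continuous.ae_eq_iff_eq volume continuous_zero).1 ?_
  filter_upwards [h] with s hs
  simpa using hs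

lemma ae_eq_superpose {f φ : V → ℂ} (hfm : Measurable f) (hf : MemLp f 2)
    (hφ : ExpLocalized φ) (h0 : φ ≠ 0) (hi : Integrable (fun p : V × V => stft φ f p.1 p.2)) :
    f =ᵐ[volume] superpose volume
      (fun p : V × V => ((∫ s, ‖φ s‖ ^ 2 : ℝ) : ℂ)⁻¹ * stft φ f p.1 p.2) Prod.fst Prod.snd φ := by
  have hc : ((∫ s, ‖φ s‖ ^ 2 : ℝ) : ℂ) ≠ 0 := by exact_mod_cast hφ.integral_sq_ne_zero h0
  filter_upwards [mul_integral_sq_eq_superpose hfm hf hφ hi] with t ht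
  simp only [superpose, mul_assoc] at ht ⊢
  rw [integral_const_mul, ← ht]
  field_simp

/-- Every `f ∈ S₀(V)` is a superposition of time-frequency shifts of any given window. -/
lemma S0.exists_superpose (Φ : Window V) {ψ : V → ℂ} (hψ : ExpLocalized ψ) (hψ0 : ψ ≠ 0) :
    ∃ C : ℝ, 0 ≤ C ∧ ∀ f : S0 Φ, ∃ a : V × V → ℂ, Integrable a ∧ ∫ p, ‖a p‖ ≤ C * ‖f‖ ∧
      (f : V → ℂ) =ᵐ[volume] superpose volume a Prod.fst Prod.snd ψ := by
  set c : ℂ := ((∫ s, ‖Φ.toFun s‖ ^ 2 : ℝ) : ℂ)⁻¹ with hc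
  set c' : ℂ := ((∫ s, ‖ψ s‖ ^ 2 : ℝ) : ℂ)⁻¹ with hc'
  refine ⟨‖c'‖ * (‖c‖ * ∫ z, ‖stftPhase ψ Φ.toFun z‖), by positivity, fun f => ?_⟩
  have hfm : Measurable (f : V → ℂ) := (Lp.stronglyMeasurable f.toL2).measurable
  have hf := Lp.memLp f.toL2
  have h1 := ae_eq_superpose hfm hf Φ.expLocalized Φ.ne_zero f.integrable_stft
  rw [← hc] at h1
  -- Change of window: the expansion in shifts of `Φ` shows `V_ψ f ∈ L¹`, and a second inversion,
  -- now with `ψ`, gives the required coefficients.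
  obtain ⟨h2, h3⟩ := integrable_stft_superpose hψ Φ.expLocalized
    (f.integrable_stft.const_mul c) measurable_fst measurable_snd
  rw [← stft_congr ψ h1] at h2 h3
  have h4 := ae_eq_superpose hfm hf hψ hψ0 h2
  rw [← hc'] at h4
  refine ⟨_, h2.const_mul c', ?_, h4⟩
  simp only [norm_mul, integral_const_mul] at h3 ⊢
  rw [← S0.norm_def] at h3
  calc ‖c'‖ * ∫ p : V × V, ‖stft ψ f p.1 p.2‖
      ≤ ‖c'‖ * (‖c‖ * ‖f‖ * ∫ z, ‖stftPhase ψ Φ.toFun z‖) :=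
        mul_le_mul_of_nonneg_left h3 (norm_nonneg _)
    _ = _ := by ring

lemma S0.exists_of_memLp (φ : Window V) {f : V → ℂ} (hf : MemLp f 2)
    (hi : Integrable (fun p : V × V => stft φ.toFun f p.1 p.2)) :
    ∃ B : S0 φ, (B : V → ℂ) =ᵐ[volume] f ∧
      ‖B‖ = ∫ p : V × V, ‖stft φ.toFun f p.1 p.2‖ := by
  have h : (hf.toLp f : V → ℂ) =ᵐ[volume] f := hf.coeFn_toLp
  have hmem : hf.toLp f ∈ feichtingerSubmodule φ := by
    change Integrable (fun p : V × V => stft φ.toFun (hf.toLp f) p.1 p.2)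
    rwa [stft_congr _ h]
  let B : S0 φ := ⟨hf.toLp f, hmem⟩
  refine ⟨B, h, ?_⟩
  rw [S0.norm_def, ← stft_congr _ h]
  rfl

/-- Superpositions of time-frequency shifts of a localized function belong to `S₀(V)`. -/
lemma S0.exists_eq_superpose [SFinite μ] (φ : Window V) (hγ : ExpLocalized γ)
    (hm : Integrable m μ) (hx : Measurable x) (hη : Measurable η) :
    ∃ B : S0 φ, (B : V → ℂ) =ᵐ[volume] superpose μ m x η γ ∧
      ‖B‖ ≤ (∫ y, ‖m y‖ ∂μ) * ∫ z, ‖stftPhase φ.toFun γ z‖ := by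
  obtain ⟨h1, h2⟩ := integrable_stft_superpose φ.expLocalized hγ hm hx hη
  obtain ⟨B, hB, hB'⟩ := S0.exists_of_memLp φ (memLp_two_superpose hγ hm hx hη) h1
  exact ⟨B, hB, hB'.trans_le h2⟩

lemma stft_congr_window {g g₂ : V → ℂ} (h : g =ᵐ[volume] g₂) (f : V → ℂ) :
    stft g f = stft g₂ f := by
  funext x ω
  refine integral_congr_ae ?_
  filter_upwards [(measurePreserving_sub_right volume x).quasiMeasurePreserving.ae_eq_comp h]
    with t ht
  rw [show g (t - x) = g₂ (t - x) from ht]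

/-- The restriction of a superposition of shifts of `u ⊗ v` to a slice of the phase space. -/
lemma superpose_tensor_slice (a : WithLp 2 (V × V) × WithLp 2 (V × V) → ℂ) (u v : V → ℂ)
    (x ω : V) :
    superpose volume a Prod.fst Prod.snd (tensor u v) (WithLp.toLp 2 (x, ω)) =
      superpose volume (fun w => a w * tfShift w.1.fst w.2.fst u x) (fun w => w.1.snd)
        (fun w => w.2.snd) v ω := by
  refine integral_congr_ae (Filter.Eventually.of_forall fun w => ?_)
  simp only [tfShift, tensor, WithLp.prod_inner_apply]
  change a w * (phase (⟪w.2.fst, x⟫_ℝ + ⟪w.2.snd, ω⟫_ℝ) * (u (x - w.1.fst) * v (ω - w.1.snd))) = _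
  rw [phase_add]
  ring

/-- On a slice at fixed `x`, the first tensor factor is absorbed into the coefficients; their `L¹`
bound is uniform in `x`. -/
lemma integrable_mul_tfShift_fst {a : WithLp 2 (V × V) × WithLp 2 (V × V) → ℂ}
    (ha : Integrable a) {u : V → ℂ} (hu : ExpLocalized u) {C : ℝ} (hC : ∀ t, ‖u t‖ ≤ C) (x : V) :
    Integrable (fun w => a w * tfShift w.1.fst w.2.fst u x) ∧
      ∫ w, ‖a w * tfShift w.1.fst w.2.fst u x‖ ≤ (∫ w, ‖a w‖) * C := by
  have hc := hu.continuous
  have h1 : Integrable (fun w => a w * tfShift w.1.fst w.2.fst u x) := by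
    refine ha.mul_bdd (c := C) ?_ (Filter.Eventually.of_forall fun w => ?_)
    · unfold tfShift
      exact Continuous.aestronglyMeasurable (by fun_prop)
    · rw [norm_tfShift]
      exact hC _
  refine ⟨h1, ?_⟩
  rw [← integral_mul_const]
  refine integral_mono h1.norm (ha.norm.mul_const C) fun w => ?_
  simp only [norm_mul, norm_tfShift]
  exact mul_le_mul_of_nonneg_left (hC _) (norm_nonneg _)

lemma measurable_snd_comp_fst_snd :
    Measurable (fun w : WithLp 2 (V × V) × WithLp 2 (V × V) => w.1.snd) ∧
      Measurable (fun w : WithLp 2 (V × V) × WithLp 2 (V × V) => w.2.snd) :=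
  ⟨Continuous.measurable (by fun_prop), Continuous.measurable (by fun_prop)⟩

/-! ### The Gabor product and `Â` for integrable `F` and atomic `H` -/

section Gabor

variable {d : ℕ} {F H : PhaseSpace d → ℂ} {a : PhaseSpace d × PhaseSpace d → ℂ}
  {u : Space d → ℂ}

lemma gaborIntegrand_eq_phase (g : Space d → ℂ) (F H : PhaseSpace d → ℂ) (x ω : Space d)
    (q : Space d × Space d × Space d) :
    gaborIntegrand g F H x ω q = conj (𝓕 g (q.2.1 + q.2.2 - ω)) * phase ⟪x, q.2.1 + q.2.2 - ω⟫_ℝ *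
      (F (pt q.1 q.2.1) * H (pt q.1 q.2.2)) := by
  rw [gaborIntegrand, phase, mul_right_comm (2 : ℂ)]
  ring

/-- For fixed `ξ` the map `(x', ω') ↦ (x', ξ - ω')` preserves measure, so `Â` is independent of
representatives at every point, not just almost everywhere. -/
lemma auxHat_integrand_congr {F' H' : PhaseSpace d → ℂ} (hF : F =ᵐ[volume] F')
    (hH : H =ᵐ[volume] H') (ξ : Space d) :
    (fun q : Space d × Space d => F (pt q.1 q.2) * H (pt q.1 (ξ - q.2))) =ᵐ[volume]
      fun q => F' (pt q.1 q.2) * H' (pt q.1 (ξ - q.2)) := by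
  have h1 := WithLp.volume_preserving_toLp (Space d) (Space d)
  have h2 : MeasurePreserving (Prod.map id (fun t : Space d => ξ - t))
      ((volume : Measure (Space d)).prod volume) (volume.prod volume) :=
    (MeasurePreserving.id _).prod (Measure.measurePreserving_sub_left volume ξ)
  filter_upwards [h1.quasiMeasurePreserving.ae_eq_comp hF,
    (h1.comp h2).quasiMeasurePreserving.ae_eq_comp hH] with q hq hq'
  exact congrArg₂ (· * ·) hq hq'

lemma auxHat_congr {F' H' : PhaseSpace d → ℂ} (hF : F =ᵐ[volume] F') (hH : H =ᵐ[volume] H') :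
    auxHat F H = auxHat F' H' :=
  funext fun ξ => integral_congr_ae (auxHat_integrand_congr hF hH ξ)

lemma gaborIntegrand_congr {F' H' : PhaseSpace d → ℂ} (hF : F =ᵐ[volume] F')
    (hH : H =ᵐ[volume] H') (g : Space d → ℂ) (x ω : Space d) :
    gaborIntegrand g F H x ω =ᵐ[volume] gaborIntegrand g F' H' x ω := by
  have h1 := (WithLp.volume_preserving_toLp (Space d) (Space d)).quasiMeasurePreserving
  have h2 : Measure.QuasiMeasurePreserving (Prod.map id Prod.fst)
      ((volume : Measure (Space d)).prod ((volume : Measure (Space d)).prod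
        (volume : Measure (Space d)))) (volume.prod volume) :=
    MeasureTheory.QuasiMeasurePreserving.prodMap (Measure.QuasiMeasurePreserving.id _)
      Measure.quasiMeasurePreserving_fst
  have h3 : Measure.QuasiMeasurePreserving (Prod.map id Prod.snd)
      ((volume : Measure (Space d)).prod ((volume : Measure (Space d)).prod
        (volume : Measure (Space d)))) (volume.prod volume) :=
    MeasureTheory.QuasiMeasurePreserving.prodMap (Measure.QuasiMeasurePreserving.id _)
      Measure.quasiMeasurePreserving_snd
  filter_upwards [(h1.comp h2).ae_eq_comp hF, (h1.comp h3).ae_eq_comp hH] with q hq hq'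
  have e1 : F (pt q.1 q.2.1) = F' (pt q.1 q.2.1) := hq
  have e2 : H (pt q.1 q.2.2) = H' (pt q.1 q.2.2) := hq'
  rw [gaborIntegrand, gaborIntegrand, e1, e2]

lemma gaborProduct_congr {F' H' : PhaseSpace d → ℂ} (hF : F =ᵐ[volume] F')
    (hH : H =ᵐ[volume] H') (g : Space d → ℂ) : gaborProduct g F H = gaborProduct g F' H' :=
  funext fun z => integral_congr_ae (gaborIntegrand_congr hF hH g z.fst z.snd)

/-- The slices `H(x', ·)` have `L¹` norms bounded uniformly in `x'`, so integrability of `F` is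
enough. The shift `s` serves both parametrizations: `s = 0` for the variable `ω''`, and `s = ω'` for
`ξ = ω' + ω''`. -/
lemma integrable_slice_product (hF : Integrable F) (ha : Integrable a) (hu : ExpLocalized u)
    {s : Space d × Space d → Space d} (hs : Continuous s) :
    Integrable (fun r : (Space d × Space d) × Space d => F (pt r.1.1 r.1.2) *
      superpose volume a Prod.fst Prod.snd (tensor u u) (pt r.1.1 (r.2 - s r.1)))
      (volume.prod volume) := by
  obtain ⟨C, hC0, hC⟩ := hu.decay.bounded
  have hF' : Integrable (fun q : Space d × Space d => F (pt q.1 q.2)) :=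
    integrable_comp_toLp_iff.2 hF
  have hcont := continuous_superpose (hu.tensor hu) ha measurable_fst measurable_snd
  have hS : AEStronglyMeasurable (fun r : (Space d × Space d) × Space d => F (pt r.1.1 r.1.2) *
      superpose volume a Prod.fst Prod.snd (tensor u u) (pt r.1.1 (r.2 - s r.1)))
      (volume.prod volume) := by
    refine AEStronglyMeasurable.mul hF'.1.comp_fst ?_
    exact (hcont.comp ((WithLp.prod_continuous_toLp 2 _ _).comp
      (by fun_prop))).aestronglyMeasurable
  have hsl : ∀ x : Space d, Integrable (fun ω => superpose volume a Prod.fst Prod.snd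
      (tensor u u) (pt x ω)) ∧ ∫ ω, ‖superpose volume a Prod.fst Prod.snd
      (tensor u u) (pt x ω)‖ ≤ (∫ w, ‖a w‖) * C * ∫ t, ‖u t‖ := by
    intro x
    obtain ⟨i1, i2⟩ := integrable_mul_tfShift_fst ha hu hC x
    simp only [superpose_tensor_slice]
    refine ⟨integrable_superpose hu i1 measurable_snd_comp_fst_snd.1 measurable_snd_comp_fst_snd.2,
      (integral_norm_superpose_le hu i1 measurable_snd_comp_fst_snd.1
        measurable_snd_comp_fst_snd.2).trans ?_⟩
    exact mul_le_mul_of_nonneg_right i2 (by positivity)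
  refine (integrable_prod_iff hS).2 ⟨Filter.Eventually.of_forall fun q => ?_, ?_⟩
  · exact ((hsl q.1).1.comp_sub_right (s q)).const_mul (F (pt q.1 q.2))
  · refine (hF'.norm.mul_const ((∫ w, ‖a w‖) * C * ∫ t, ‖u t‖)).mono' hS.norm.integral_prod_right'
      (Filter.Eventually.of_forall fun q => ?_)
    rw [Real.norm_of_nonneg (by positivity)]
    simp only [norm_mul]
    rw [integral_const_mul, integral_sub_right_eq_self (fun ω => ‖superpose volume a Prod.fst
      Prod.snd (tensor u u) (pt q.1 ω)‖)]
    exact mul_le_mul_of_nonneg_left (hsl q.1).2 (norm_nonneg _)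

/-- The multiplier of the Gabor product in the frequency variable is bounded. -/
lemma norm_multiplier_le (g : Space d → ℂ) (x ζ : Space d) :
    ‖conj (𝓕 g ζ) * phase ⟪x, ζ⟫_ℝ‖ ≤ ∫ t, ‖g t‖ := by
  rw [norm_mul, norm_phase, mul_one, RCLike.norm_conj]
  exact norm_fourier_le g ζ

lemma measurePreserving_prodAssoc_space :
    MeasurePreserving (MeasurableEquiv.prodAssoc (α := Space d) (β := Space d) (γ := Space d))
      (volume.prod volume) volume :=
  ⟨MeasurableEquiv.prodAssoc.measurable, Measure.prodAssoc_prod⟩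

lemma integrable_multiplier_mul {g : Space d → ℂ} (hg : Integrable g)
    {K : (Space d × Space d) × Space d → ℂ} (hK : Integrable K (volume.prod volume))
    {ζ : (Space d × Space d) × Space d → Space d} (hζ : Continuous ζ) (x : Space d) :
    Integrable (fun r => conj (𝓕 g (ζ r)) * phase ⟪x, ζ r⟫_ℝ * K r) (volume.prod volume) := by
  have := continuous_fourier hg
  exact hK.bdd_mul (c := ∫ t, ‖g t‖) (Continuous.aestronglyMeasurable (by fun_prop))
    (Filter.Eventually.of_forall fun r => norm_multiplier_le g x _)

lemma integrable_gaborIntegrand {g : Space d → ℂ} (hg : Integrable g) (hF : Integrable F)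
    (ha : Integrable a) (hu : ExpLocalized u) (x ω : Space d) :
    Integrable (gaborIntegrand g F (superpose volume a Prod.fst Prod.snd (tensor u u)) x ω) := by
  rw [← measurePreserving_prodAssoc_space.integrable_comp_emb
    MeasurableEquiv.prodAssoc.measurableEmbedding]
  have h := integrable_slice_product hF ha hu (s := fun _ => 0) continuous_const
  simp only [sub_zero] at h
  have h' := integrable_multiplier_mul hg h (ζ := fun r => r.1.2 + r.2 - ω) (by fun_prop) x
  refine h'.congr (Filter.Eventually.of_forall fun r => ?_)
  change _ = gaborIntegrand g F _ x ω (r.1.1, r.1.2, r.2)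
  rw [gaborIntegrand_eq_phase]

/-- The Gabor product in terms of `Â`. -/
lemma gaborProduct_eq_integral_auxHat {g : Space d → ℂ} (hg : Integrable g) (hF : Integrable F)
    (ha : Integrable a) (hu : ExpLocalized u)
    (hH : H = superpose volume a Prod.fst Prod.snd (tensor u u)) (x ω : Space d) :
    gaborProduct g F H (pt x ω) =
      ∫ ξ, auxHat F H ξ * (conj (𝓕 g (ξ - ω)) * phase ⟪x, ξ - ω⟫_ℝ) := by
  have h0 := integrable_gaborIntegrand hg hF ha hu x ω
  have h1 := integrable_slice_product hF ha hu (s := fun q => q.2) continuous_snd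
  have h2 := integrable_multiplier_mul hg h1 (ζ := fun r => r.2 - ω) (by fun_prop) x
  rw [← hH] at h0 h1 h2
  rw [← measurePreserving_prodAssoc_space.integrable_comp_emb
    MeasurableEquiv.prodAssoc.measurableEmbedding] at h0
  calc gaborProduct g F H (pt x ω)
      = ∫ r : (Space d × Space d) × Space d,
          gaborIntegrand g F H x ω (MeasurableEquiv.prodAssoc r) ∂(volume.prod volume) :=
        (measurePreserving_prodAssoc_space.integral_comp
          MeasurableEquiv.prodAssoc.measurableEmbedding _).symm
    _ = ∫ q : Space d × Space d, ∫ η : Space d,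
          gaborIntegrand g F H x ω (MeasurableEquiv.prodAssoc (q, η)) := integral_prod _ h0
    _ = ∫ q : Space d × Space d, ∫ ξ : Space d, conj (𝓕 g (ξ - ω)) * phase ⟪x, ξ - ω⟫_ℝ *
          (F (pt q.1 q.2) * H (pt q.1 (ξ - q.2))) := by
        refine integral_congr_ae (Filter.Eventually.of_forall fun q => ?_)
        simp only
        -- The substitution `ω'' = ξ - ω'`.
        rw [← integral_sub_right_eq_self _ q.2]
        refine integral_congr_ae (Filter.Eventually.of_forall fun ξ => ?_)
        simp only [gaborIntegrand_eq_phase]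
        change conj (𝓕 g (q.2 + (ξ - q.2) - ω)) * phase ⟪x, q.2 + (ξ - q.2) - ω⟫_ℝ *
          (F (pt q.1 q.2) * H (pt q.1 (ξ - q.2))) = _
        rw [add_sub_cancel]
    _ = ∫ ξ : Space d, ∫ q : Space d × Space d, conj (𝓕 g (ξ - ω)) * phase ⟪x, ξ - ω⟫_ℝ *
          (F (pt q.1 q.2) * H (pt q.1 (ξ - q.2))) := integral_integral_swap h2
    _ = _ := by
        refine integral_congr_ae (Filter.Eventually.of_forall fun ξ => ?_)
        simp only
        rw [integral_const_mul, auxHat, mul_comm]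

/-- The coefficients of `Â` as a superposition of time-frequency shifts of `u`. -/
def auxCoeff (F : PhaseSpace d → ℂ) (a : PhaseSpace d × PhaseSpace d → ℂ) (u : Space d → ℂ)
    (y : (Space d × Space d) × (PhaseSpace d × PhaseSpace d)) : ℂ :=
  F (pt y.1.1 y.1.2) * a y.2 * (phase (⟪y.2.2.fst, y.1.1⟫_ℝ - ⟪y.2.2.snd, y.1.2⟫_ℝ) *
    u (y.1.1 - y.2.1.fst))

lemma integrable_auxCoeff (hF : Integrable F) (ha : Integrable a) (hu : ExpLocalized u) {C : ℝ}
    (hC : ∀ t, ‖u t‖ ≤ C) : Integrable (auxCoeff F a u) (volume.prod volume) ∧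
      ∫ y, ‖auxCoeff F a u y‖ ∂(volume.prod volume) ≤ (∫ z, ‖F z‖) * (∫ w, ‖a w‖) * C := by
  have hc := hu.continuous
  have hF' : Integrable (fun q : Space d × Space d => F (pt q.1 q.2)) :=
    integrable_comp_toLp_iff.2 hF
  have h0 := hF'.mul_prod ha
  have hb : ∀ y : (Space d × Space d) × (PhaseSpace d × PhaseSpace d),
      ‖phase (⟪y.2.2.fst, y.1.1⟫_ℝ - ⟪y.2.2.snd, y.1.2⟫_ℝ) * u (y.1.1 - y.2.1.fst)‖ ≤ C := by
    intro y
    rw [norm_mul, norm_phase, one_mul]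
    exact hC _
  have h1 : Integrable (auxCoeff F a u) (volume.prod volume) :=
    h0.mul_bdd (c := C) (Continuous.aestronglyMeasurable (by fun_prop))
      (Filter.Eventually.of_forall hb)
  refine ⟨h1, ?_⟩
  calc ∫ y, ‖auxCoeff F a u y‖ ∂(volume.prod volume)
      ≤ ∫ y : (Space d × Space d) × (PhaseSpace d × PhaseSpace d),
        ‖F (pt y.1.1 y.1.2) * a y.2‖ * C ∂(volume.prod volume) := by
        refine integral_mono h1.norm (h0.norm.mul_const C) fun y => ?_
        simp only [auxCoeff]
        rw [norm_mul]
        exact mul_le_mul_of_nonneg_left (hb y) (norm_nonneg _)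
    _ = _ := by
        rw [integral_mul_const, ← integral_comp_toLp (fun z => ‖F z‖)]
        simp only [norm_mul]
        rw [← integral_prod_mul (fun q : Space d × Space d => ‖F (WithLp.toLp 2 q)‖)]

/-- The second factor of an atom, evaluated at `ξ - ω'`, is a shift of `u` in `ξ` displaced by a
further `ω'`; everything independent of `ξ` goes into the coefficient. -/
lemma mul_superpose_eq_integral_auxCoeff (ξ : Space d) (q : Space d × Space d) :
    F (pt q.1 q.2) * superpose volume a Prod.fst Prod.snd (tensor u u) (pt q.1 (ξ - q.2)) =
      ∫ w, auxCoeff F a u (q, w) * tfShift (q.2 + w.1.snd) w.2.snd u ξ := by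
  rw [superpose_tensor_slice, superpose, ← integral_const_mul]
  refine integral_congr_ae (Filter.Eventually.of_forall fun w => ?_)
  simp only [auxCoeff, tfShift, inner_sub_right, sub_eq_add_neg (inner ℝ _ _), phase_add]
  rw [sub_add_eq_sub_sub]
  ring

lemma integrable_auxCoeff_mul (hF : Integrable F) (ha : Integrable a) (hu : ExpLocalized u)
    (ξ : Space d) :
    Integrable (fun y : (Space d × Space d) × (PhaseSpace d × PhaseSpace d) =>
      auxCoeff F a u y * tfShift (y.1.2 + y.2.1.snd) y.2.2.snd u ξ) (volume.prod volume) := by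
  obtain ⟨C, -, hC⟩ := hu.decay.bounded
  have hc := hu.continuous
  refine (integrable_auxCoeff hF ha hu hC).1.mul_bdd (c := C) ?_
    (Filter.Eventually.of_forall fun y => ?_)
  · unfold tfShift
    exact Continuous.aestronglyMeasurable (by fun_prop)
  · rw [norm_tfShift]
    exact hC _

lemma integrable_auxHat_integrand (hF : Integrable F) (ha : Integrable a) (hu : ExpLocalized u)
    (ξ : Space d) :
    Integrable (fun q : Space d × Space d => F (pt q.1 q.2) *
      superpose volume a Prod.fst Prod.snd (tensor u u) (pt q.1 (ξ - q.2))) := by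
  simp only [mul_superpose_eq_integral_auxCoeff]
  exact (integrable_auxCoeff_mul hF ha hu ξ).integral_prod_left

lemma auxHat_eq_superpose (hF : Integrable F) (ha : Integrable a) (hu : ExpLocalized u) :
    auxHat F (superpose volume a Prod.fst Prod.snd (tensor u u)) =
      superpose (volume.prod volume) (auxCoeff F a u) (fun y => y.1.2 + y.2.1.snd)
        (fun y => y.2.2.snd) u := by
  funext ξ
  rw [superpose, integral_prod _ (integrable_auxCoeff_mul hF ha hu ξ), auxHat]
  exact integral_congr_ae
    (Filter.Eventually.of_forall fun q => mul_superpose_eq_integral_auxCoeff ξ q)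

end Gabor

/-! ### The auxiliary function `A` and its short-time Fourier transform -/

section Main

variable {d : ℕ} {F H : PhaseSpace d → ℂ} {a : PhaseSpace d × PhaseSpace d → ℂ}
  {u : Space d → ℂ}

instance : SFinite ((volume : Measure (Space d × Space d)).prod
    (volume : Measure (PhaseSpace d × PhaseSpace d))) :=
  Measure.prod.instSFinite

lemma measurable_auxPos_auxFreq :
    Measurable (fun y : (Space d × Space d) × (PhaseSpace d × PhaseSpace d) =>
      y.1.2 + y.2.1.snd) ∧
    Measurable (fun y : (Space d × Space d) × (PhaseSpace d × PhaseSpace d) => y.2.2.snd) :=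
  ⟨Continuous.measurable (by fun_prop), Continuous.measurable (by fun_prop)⟩

lemma integrable_auxCoeff_mul_phase (hF : Integrable F) (ha : Integrable a)
    (hu : ExpLocalized u) :
    Integrable (fun y : (Space d × Space d) × (PhaseSpace d × PhaseSpace d) =>
      auxCoeff F a u y * phase ⟪y.2.2.snd, y.1.2 + y.2.1.snd⟫_ℝ) (volume.prod volume) := by
  obtain ⟨C, -, hC⟩ := hu.decay.bounded
  exact integrable_mul_phase (integrable_auxCoeff hF ha hu hC).1
    (measurable_auxPos_auxFreq.2.inner measurable_auxPos_auxFreq.1)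

lemma aux_eq_superpose (hF : Integrable F) (ha : Integrable a) (hu : ExpLocalized u) :
    aux F (superpose volume a Prod.fst Prod.snd (tensor u u)) =
      superpose (volume.prod volume)
        (fun y => auxCoeff F a u y * phase ⟪y.2.2.snd, y.1.2 + y.2.1.snd⟫_ℝ)
        (fun y => -y.2.2.snd) (fun y => y.1.2 + y.2.1.snd) (𝓕⁻ u) := by
  obtain ⟨C, -, hC⟩ := hu.decay.bounded
  rw [aux, auxHat_eq_superpose hF ha hu,
    fourierInv_superpose hu (integrable_auxCoeff hF ha hu hC).1 measurable_auxPos_auxFreq.1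
      measurable_auxPos_auxFreq.2]

lemma integrable_auxHat (hF : Integrable F) (ha : Integrable a) (hu : ExpLocalized u) :
    Integrable (auxHat F (superpose volume a Prod.fst Prod.snd (tensor u u))) := by
  obtain ⟨C, -, hC⟩ := hu.decay.bounded
  rw [auxHat_eq_superpose hF ha hu]
  exact integrable_superpose hu (integrable_auxCoeff hF ha hu hC).1 measurable_auxPos_auxFreq.1
    measurable_auxPos_auxFreq.2

/-- `Â` is continuous and integrable, and `𝓕 Â` is the reflection of `A`, which is integrable as a
superposition; hence inversion holds everywhere. -/
lemma fourier_aux (hF : Integrable F) (ha : Integrable a) (hu : ExpLocalized u)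
    (hH : H = superpose volume a Prod.fst Prod.snd (tensor u u)) :
    𝓕 (aux F H) = auxHat F H := by
  obtain ⟨C, -, hC⟩ := hu.decay.bounded
  have h1 : Continuous (auxHat F H) := by
    rw [hH, auxHat_eq_superpose hF ha hu]
    exact continuous_superpose hu (integrable_auxCoeff hF ha hu hC).1 measurable_auxPos_auxFreq.1
      measurable_auxPos_auxFreq.2
  have h2 : Integrable (aux F H) := by
    rw [hH, aux_eq_superpose hF ha hu]
    exact integrable_superpose hu.fourierInv (integrable_auxCoeff_mul_phase hF ha hu)
      measurable_auxPos_auxFreq.2.neg measurable_auxPos_auxFreq.1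
  have h3 : Integrable (𝓕 (auxHat F H)) := by
    refine h2.comp_neg.congr (Filter.Eventually.of_forall fun ξ => ?_)
    simp only [aux]
    rw [Real.fourierInv_eq_fourier_neg, neg_neg]
  exact h1.fourier_fourierInv_eq (hH ▸ integrable_auxHat hF ha hu) h3

lemma gaborProduct_eq_stft {g : Space d → ℂ} (hg : Integrable g) (hF : Integrable F)
    (ha : Integrable a) (hu : ExpLocalized u)
    (hH : H = superpose volume a Prod.fst Prod.snd (tensor u u)) (x ω : Space d) :
    gaborProduct g F H (pt x ω) = stft g (aux F H) x ω := by
  rw [gaborProduct_eq_integral_auxHat hg hF ha hu hH, aux,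
    stft_fourierInv hg (hH ▸ integrable_auxHat hF ha hu)]

/-- The short-time Fourier transform of `A`, as a superposition on the phase space. -/
lemma exists_S0_stftPhase_aux (Φ : Window (PhaseSpace d)) {g : Space d → ℂ}
    {b : Space d × Space d → ℂ} {γ' : Space d → ℂ} (hγ' : ExpLocalized γ') (hb : Integrable b)
    (hg : g =ᵐ[volume] superpose volume b Prod.fst Prod.snd γ') (hF : Integrable F)
    (ha : Integrable a) (hu : ExpLocalized u)
    (hH : H = superpose volume a Prod.fst Prod.snd (tensor u u)) {C : ℝ} (hC : ∀ t, ‖u t‖ ≤ C) :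
    ∃ P : S0 Φ, (P : PhaseSpace d → ℂ) =ᵐ[volume] stftPhase g (aux F H) ∧
      ‖P‖ ≤ ((∫ z, ‖F z‖) * (∫ w, ‖a w‖) * C * ∫ p, ‖b p‖) *
        ∫ z, ‖stftPhase Φ.toFun (stftPhase γ' (𝓕⁻ u)) z‖ := by
  have hm := integrable_auxCoeff_mul_phase hF ha hu
  have hb' : Integrable (fun p => conj (b p)) :=
    (LinearIsometryEquiv.integrable_comp_iff Complex.conjLIE).2 hb
  have h1 : stftPhase g (aux F H) = stftPhase (superpose volume b Prod.fst Prod.snd γ')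
      (aux F H) := by
    funext z
    rw [stftPhase, stftPhase, stft_congr_window hg]
  rw [h1, hH, aux_eq_superpose hF ha hu, stftPhase_superpose (x := fun y => -y.2.2.snd)
    hu.fourierInv hm measurable_auxPos_auxFreq.2.neg measurable_auxPos_auxFreq.1 hγ' hb
    measurable_fst measurable_snd]
  have hr : Measurable (fun p : ((Space d × Space d) × (PhaseSpace d × PhaseSpace d)) ×
      (Space d × Space d) => ⟪p.1.1.2 + p.1.2.1.snd - p.2.2, -p.1.2.2.snd⟫_ℝ) :=
    Continuous.measurable (by fun_prop)
  -- All atoms of `V_g A` are shifts of `V_γ' (𝓕⁻ u)`. The double negation below keeps the form that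
  -- `stftPhase_superpose` gives for positions `-y.2.2.snd`.
  obtain ⟨P, hP, hP'⟩ := S0.exists_eq_superpose Φ (hu.fourierInv.stftPhase hγ')
    (integrable_mul_phase (hm.mul_prod hb') hr)
    (x := fun p => WithLp.toLp 2 (-p.1.2.2.snd - p.2.1, p.1.1.2 + p.1.2.1.snd - p.2.2))
    (η := fun p => WithLp.toLp 2 (p.2.2, -(-p.1.2.2.snd)))
    ((WithLp.prod_continuous_toLp 2 _ _).comp (by fun_prop)).measurable
    ((WithLp.prod_continuous_toLp 2 _ _).comp (by fun_prop)).measurable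
  refine ⟨P, hP, hP'.trans (mul_le_mul_of_nonneg_right ?_ (by positivity))⟩
  simp only [norm_mul, norm_phase, mul_one, RCLike.norm_conj]
  rw [integral_prod_mul (fun y => ‖auxCoeff F a u y‖) (fun p => ‖b p‖)]
  exact mul_le_mul_of_nonneg_right (integrable_auxCoeff hF ha hu hC).2 (by positivity)

/-! ### Transfer to elements of `S₀` -/

lemma Window.tensor_ne_zero (φ : Window (Space d)) : tensor φ.toFun φ.toFun ≠ 0 := by
  intro h
  apply φ.ne_zero
  funext t
  have h1 : φ.toFun t * φ.toFun t = 0 := congrFun h (pt t t)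
  exact mul_self_eq_zero.1 h1

lemma S0.exists_integral_norm_le (φ : Window V) :
    ∃ C : ℝ, 0 ≤ C ∧ ∀ f : S0 φ, Integrable (f : V → ℂ) ∧ ∫ t, ‖f t‖ ≤ C * ‖f‖ := by
  obtain ⟨C, hC, h⟩ := S0.exists_superpose φ φ.expLocalized φ.ne_zero
  refine ⟨C * ∫ t, ‖φ.toFun t‖, by positivity, fun f => ?_⟩
  obtain ⟨a, ha, ha', hf⟩ := h f
  refine ⟨(integrable_superpose φ.expLocalized ha measurable_fst measurable_snd).congr hf.symm, ?_⟩
  have h1 : ∫ t, ‖f t‖ = ∫ t, ‖superpose volume a Prod.fst Prod.snd φ.toFun t‖ :=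
    integral_congr_ae (hf.fun_comp norm)
  rw [h1]
  refine (integral_norm_superpose_le φ.expLocalized ha measurable_fst measurable_snd).trans ?_
  calc (∫ p, ‖a p‖) * ∫ t, ‖φ.toFun t‖ ≤ (C * ‖f‖) * ∫ t, ‖φ.toFun t‖ :=
        mul_le_mul_of_nonneg_right ha' (by positivity)
    _ = _ := by ring

lemma S0.integrable {φ : Window V} (f : S0 φ) : Integrable (f : V → ℂ) :=
  ((S0.exists_integral_norm_le φ).choose_spec.2 f).1

lemma S0.coeFn_sub {φ : Window V} (f h : S0 φ) :
    ((f - h : S0 φ) : V → ℂ) =ᵐ[volume] (f : V → ℂ) - (h : V → ℂ) :=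
  Lp.coeFn_sub f.toL2 h.toL2

lemma S0.eq_of_ae_eq {φ : Window V} {f h : S0 φ} (e : (f : V → ℂ) =ᵐ[volume] (h : V → ℂ)) :
    f = h :=
  S0.toL2_injective (Lp.ext e)

lemma S0.integrable_gaborIntegrand {φ : Window (Space d)} {Φ : Window (PhaseSpace d)}
    (g : S0 φ) (F H : S0 Φ) (x ω : Space d) : Integrable (gaborIntegrand g F H x ω) := by
  obtain ⟨_, -, h⟩ := S0.exists_superpose Φ (φ.expLocalized.tensor φ.expLocalized)
    φ.tensor_ne_zero
  obtain ⟨a, ha, -, hH⟩ := h H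
  exact (GaborProduct.integrable_gaborIntegrand g.integrable F.integrable ha φ.expLocalized
    x ω).congr (gaborIntegrand_congr (Filter.EventuallyEq.refl _ _) hH.symm _ _ _)

/-- The Gabor product is bounded on `S₀`. -/
lemma S0.exists_gaborProduct {φ : Window (Space d)} (Φ : Window (PhaseSpace d)) (g : S0 φ) :
    ∃ C : ℝ, 0 ≤ C ∧ ∀ F H : S0 Φ, ∃ P : S0 Φ,
      (P : PhaseSpace d → ℂ) =ᵐ[volume] gaborProduct g F H ∧ ‖P‖ ≤ C * ‖F‖ * ‖H‖ := by
  obtain ⟨C₁, hC₁, h₁⟩ := S0.exists_integral_norm_le Φ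
  obtain ⟨C₂, hC₂, h₂⟩ := S0.exists_superpose Φ (φ.expLocalized.tensor φ.expLocalized)
    φ.tensor_ne_zero
  obtain ⟨_, -, h₃⟩ := S0.exists_superpose φ φ.expLocalized φ.ne_zero
  obtain ⟨b, hb, -, hg⟩ := h₃ g
  obtain ⟨C, hC, hφ⟩ := φ.expLocalized.decay.bounded
  set D := ∫ z, ‖stftPhase Φ.toFun (stftPhase φ.toFun (𝓕⁻ φ.toFun)) z‖ with hD
  have hD0 : 0 ≤ D := by positivity
  have hb0 : 0 ≤ ∫ p, ‖b p‖ := by positivity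
  refine ⟨C₁ * C₂ * C * (∫ p, ‖b p‖) * D, by positivity, fun F H => ?_⟩
  obtain ⟨a, ha, ha', hH⟩ := h₂ H
  obtain ⟨P, hP, hP'⟩ := exists_S0_stftPhase_aux Φ φ.expLocalized hb hg F.integrable ha
    φ.expLocalized rfl hφ
  have hprod : gaborProduct g F H =
      stftPhase g (aux F (superpose volume a Prod.fst Prod.snd (tensor φ.toFun φ.toFun))) := by
    rw [gaborProduct_congr (Filter.EventuallyEq.refl _ _) hH]
    funext z
    exact gaborProduct_eq_stft g.integrable F.integrable ha φ.expLocalized rfl z.fst z.snd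
  refine ⟨P, hprod ▸ hP, hP'.trans ?_⟩
  have hFH : (∫ z, ‖F z‖) * (∫ w, ‖a w‖) ≤ (C₁ * ‖F‖) * (C₂ * ‖H‖) :=
    mul_le_mul (h₁ F).2 ha' (by positivity) (by positivity)
  calc ((∫ z, ‖F z‖) * (∫ w, ‖a w‖) * C * ∫ p, ‖b p‖) * D
      ≤ ((C₁ * ‖F‖) * (C₂ * ‖H‖) * C * ∫ p, ‖b p‖) * D := by gcongr
    _ = _ := by ring

/-- Absolute convergence at every point lets the integral be split; the representative of `F - F'`
matters only up to null sets. -/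
lemma S0.gaborProduct_sub_left {φ : Window (Space d)} {Φ : Window (PhaseSpace d)} (g : S0 φ)
    (F F' H : S0 Φ) :
    gaborProduct g (F - F' : S0 Φ) H = gaborProduct g F H - gaborProduct g F' H := by
  rw [gaborProduct_congr (S0.coeFn_sub F F') (Filter.EventuallyEq.refl _ _)]
  funext z
  simp only [gaborProduct, Pi.sub_apply]
  rw [← integral_sub (S0.integrable_gaborIntegrand g F H _ _)
    (S0.integrable_gaborIntegrand g F' H _ _)]
  refine integral_congr_ae (Filter.Eventually.of_forall fun q => ?_)
  simp only [gaborIntegrand, Pi.sub_apply]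
  ring

lemma S0.gaborProduct_sub_right {φ : Window (Space d)} {Φ : Window (PhaseSpace d)} (g : S0 φ)
    (F H H' : S0 Φ) :
    gaborProduct g F (H - H' : S0 Φ) = gaborProduct g F H - gaborProduct g F H' := by
  rw [gaborProduct_congr (Filter.EventuallyEq.refl _ _) (S0.coeFn_sub H H')]
  funext z
  simp only [gaborProduct, Pi.sub_apply]
  rw [← integral_sub (S0.integrable_gaborIntegrand g F H _ _)
    (S0.integrable_gaborIntegrand g F H' _ _)]
  refine integral_congr_ae (Filter.Eventually.of_forall fun q => ?_)
  simp only [gaborIntegrand, Pi.sub_apply]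
  ring

/-- A bounded biadditive map is jointly continuous. -/
lemma continuous_of_biadditive_bound {E : Type*} [NormedAddCommGroup E] {P : E → E → E}
    (h1 : ∀ F F' H, P (F - F') H = P F H - P F' H) (h2 : ∀ F H H', P F (H - H') = P F H - P F H')
    {C : ℝ} (hC : ∀ F H, ‖P F H‖ ≤ C * ‖F‖ * ‖H‖) : Continuous (fun p : E × E => P p.1 p.2) := by
  refine continuous_iff_continuousAt.2 fun p => ?_
  rw [ContinuousAt, tendsto_iff_norm_sub_tendsto_zero]
  have hlim : Filter.Tendsto (fun q : E × E => C * ‖q.1 - p.1‖ * ‖q.2‖ + C * ‖p.1‖ * ‖q.2 - p.2‖)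
      (nhds p) (nhds 0) := by
    have hc : Continuous (fun q : E × E =>
        C * ‖q.1 - p.1‖ * ‖q.2‖ + C * ‖p.1‖ * ‖q.2 - p.2‖) := by fun_prop
    simpa using hc.tendsto p
  refine squeeze_zero (fun q => norm_nonneg _) (fun q => ?_) hlim
  -- Changing one argument at a time leaves two terms, each controlled by the bound and tending to
  -- `0`.
  have e : P q.1 q.2 - P p.1 p.2 = P (q.1 - p.1) q.2 + P p.1 (q.2 - p.2) := by
    rw [h1, h2]
    abel
  rw [e]
  exact (norm_add_le _ _).trans (add_le_add (hC _ _) (hC _ _))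

lemma S0.exists_continuous_gaborProduct {φ : Window (Space d)} (Φ : Window (PhaseSpace d))
    (g : S0 φ) : ∃ P : S0 Φ → S0 Φ → S0 Φ,
      (∀ F H : S0 Φ, (P F H : PhaseSpace d → ℂ) =ᵐ[volume] gaborProduct g F H) ∧
      Continuous (fun p : S0 Φ × S0 Φ => P p.1 p.2) ∧
      ∃ C : ℝ, ∀ F H : S0 Φ, ‖P F H‖ ≤ C * ‖F‖ * ‖H‖ := by
  obtain ⟨C, -, h⟩ := S0.exists_gaborProduct Φ g
  -- `P` is chosen separately for each pair; it is still biadditive, because an element of `S₀` is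
  -- determined by its almost-everywhere class.
  choose P hP hP' using h
  refine ⟨P, hP, continuous_of_biadditive_bound (fun F F' H => ?_) (fun F H H' => ?_) hP', C, hP'⟩
  · refine S0.eq_of_ae_eq ?_
    refine (hP _ _).trans (Filter.EventuallyEq.trans ?_ (S0.coeFn_sub _ _).symm)
    rw [S0.gaborProduct_sub_left]
    exact ((hP F H).sub (hP F' H)).symm
  · refine S0.eq_of_ae_eq ?_
    refine (hP _ _).trans (Filter.EventuallyEq.trans ?_ (S0.coeFn_sub _ _).symm)
    rw [S0.gaborProduct_sub_right]
    exact ((hP F H).sub (hP F H')).symm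

lemma S0.gaborProduct_eq_stft_aux {φ : Window (Space d)} {Φ : Window (PhaseSpace d)} (g : S0 φ)
    (F H : S0 Φ) :
    (∀ ξ : Space d, Integrable
      (fun q : Space d × Space d => F (pt q.1 q.2) * H (pt q.1 (ξ - q.2))) volume) ∧
    (∃ B : S0 φ, (B : Space d → ℂ) =ᵐ[volume] auxHat F H) ∧
    (∃ A : S0 φ, (A : Space d → ℂ) =ᵐ[volume] aux F H) ∧
    𝓕 (aux F H) = auxHat F H ∧
    ∀ x ω : Space d, gaborProduct g F H (pt x ω) = stft g (aux F H) x ω := by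
  obtain ⟨_, -, h⟩ := S0.exists_superpose Φ (φ.expLocalized.tensor φ.expLocalized)
    φ.tensor_ne_zero
  obtain ⟨a, ha, -, hH⟩ := h H
  obtain ⟨C, -, hC⟩ := φ.expLocalized.decay.bounded
  have hu := φ.expLocalized
  have hF := F.integrable
  have hF' : (F : PhaseSpace d → ℂ) =ᵐ[volume] F := Filter.EventuallyEq.refl _ _
  have haux : aux F H = aux F (superpose volume a Prod.fst Prod.snd
      (tensor φ.toFun φ.toFun)) := by
    rw [aux, aux, auxHat_congr hF' hH]
  refine ⟨fun ξ => (integrable_auxHat_integrand hF ha hu ξ).congr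
    (auxHat_integrand_congr hF' hH ξ).symm, ?_, ?_, ?_, fun x ω => ?_⟩
  · obtain ⟨B, hB, -⟩ := S0.exists_eq_superpose φ hu (integrable_auxCoeff hF ha hu hC).1
      measurable_auxPos_auxFreq.1 measurable_auxPos_auxFreq.2
    rw [auxHat_congr hF' hH, auxHat_eq_superpose hF ha hu]
    exact ⟨B, hB⟩
  · obtain ⟨A, hA, -⟩ := S0.exists_eq_superpose φ hu.fourierInv
      (integrable_auxCoeff_mul_phase hF ha hu) measurable_auxPos_auxFreq.2.neg
      measurable_auxPos_auxFreq.1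
    rw [haux, aux_eq_superpose hF ha hu]
    exact ⟨A, hA⟩
  · rw [haux, auxHat_congr hF' hH]
    exact fourier_aux hF ha hu rfl
  · rw [haux, gaborProduct_congr hF' hH]
    exact gaborProduct_eq_stft g.integrable hF ha hu rfl x ω

end Main

end TimeFrequency

end GaborProduct

end

open GaborProduct in
theorem mainTheorem3 (d : ℕ) (φ : Window (Space d)) (Φ : Window (PhaseSpace d))
    (g : S0 φ) (hg : g ≠ 0) :
    -- the integral that defines the Gabor product converges absolutely at every point
    (∀ (F H : S0 Φ) (x ω : Space d), Integrable (gaborIntegrand g F H x ω) volume) ∧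
    -- the Gabor product maps into `S₀(ℝ^{2d})` and is (jointly) continuous and bounded
    (∃ P : S0 Φ → S0 Φ → S0 Φ,
      (∀ F H : S0 Φ, (P F H : PhaseSpace d → ℂ) =ᵐ[volume] gaborProduct g F H) ∧
      Continuous (fun p : S0 Φ × S0 Φ => P p.1 p.2) ∧
      ∃ C : ℝ, ∀ F H : S0 Φ, ‖P F H‖ ≤ C * ‖F‖ * ‖H‖) ∧
    -- it is the short-time Fourier transform of the auxiliary function, which lies in `S₀(ℝ^d)`
    (∀ F H : S0 Φ,
      (∀ ξ : Space d, Integrable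
        (fun q : Space d × Space d => F (pt q.1 q.2) * H (pt q.1 (ξ - q.2))) volume) ∧
      (∃ B : S0 φ, (B : Space d → ℂ) =ᵐ[volume] auxHat F H) ∧
      (∃ A : S0 φ, (A : Space d → ℂ) =ᵐ[volume] aux F H) ∧
      𝓕 (aux F H) = auxHat F H ∧
      ∀ x ω : Space d, gaborProduct g F H (pt x ω) = stft g (aux F H) x ω) :=
  ⟨fun F H x ω => S0.integrable_gaborIntegrand g F H x ω, S0.exists_continuous_gaborProduct Φ g,
    fun F H => S0.gaborProduct_eq_stft_aux g F H⟩
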